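/- Let $T^2=\mathbb R^2/\mathbb Z^2$. A homeomorphism of $T^2$ is a *shear homeomorphism* if it is isotopic to one Dehn twist along a single essential simple closed curve, i.e. isotopic to $\varphi D\varphi^{-1}$ for some homeomorphism $\varphi$ of $T^2$, where $D(x,y)=(x,y+x)$. *Standard axes* for such an $f$ are a basis $(a,b)$ of $H_1(T^2)=\mathbb Z^2$ with $f_*a=a+b$, $f_*b=b$. If $x$ is a periodic orbit of $f$ of length $p$ and $F$ is a lift of $f$ to $\mathbb R^2$, then $F^p$ moves every lift of a point of $x$ by $qa+sb$ with integers $q,s$; the *rotation number* of $x$ is $q/p \bmod 1\in[0,1)$. Periodic orbits $(x,f)$ and $(y,g)$ are *similar* (of the same type) if there is a homeomorphism $\varphi$ of $T^2$ isotopic to the identity with $\varphi(x)=y$ and $\varphi f\varphi^{-1}$ isotopic to $g$ rel $y$. The orbit $(x,f)$ *forces* $(y,g)$ if every homeomorphism having a periodic orbit similar to $(x,f)$ also has a periodic orbit similar to $(y,g)$. The orbit $(x,f)$ is of *twist type* if it forces no orbit of a different type with the same rotation number. A periodic orbit $x$ of $f$ of length $N$ is *simple* if the following hold. (1) There is a graph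 $G\subset T^2\setminus x$ consisting of a horizontal loop with $N$ vertical loops attached at $N$ points, such that some homeomorphism of $T^2$ carries the union of the circle $y=0$ and the circles $x=j/N$ ($0\le j<N$) onto $G$ and the centres $\left(\frac{2j+1}{2N},\frac12\right)$ of the complementary rectangles onto the points of the orbit (so $G$ is a deformation retract of $T^2\setminus x$). (2) There are a homeomorphism $\tilde f$ isotopic to $f$ rel $x$ and a neighbourhood of $G$ in $T^2\setminus x$ invariant under $\tilde f$ such that the action induced by $\tilde f$ on $G$ (up to homotopy in this neighbourhood) takes every vertical loop to the one $k$ places further, for a fixed $k\in\{0,\dots,N-1\}$, and takes the horizontal loop to itself with one twist around one of the vertical loops. **Lemma.** There exists an orbit of twist type for a shear homeomorphism of the torus which is not simple. More precisely, let $A_i=\left(\frac{2i-1}{8},\frac12\right)\in T^2$ for $i=1,2,3,4$ and $x=\{A_1,A_2,A_3,A_4\}$. There is a shear homeomorphism $f$ of $T^2$ with $f(A_1)=A_3$, $f(A_3)=A_2$, $f(A_2)=A_4$, $f(A_4)=A_1$, for which $x$ is a periodic orbit of length $4$ with rotation number $\frac12$, such that $x$ is of twist type and not simple; moreover, $x$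 does not force any periodic orbit that is not similar to it, and there is a homeomorphism $h$ of $T^2$, isotopic to $f$ rel $x$, such that $h^2$ has no fixed points (so $h$ has no points of period $2$). -/

import Mathlib

/-- The two-torus `(ℝ/ℤ) × (ℝ/ℤ)`, that is, the unit square with opposite sides identified. -/
abbrev Torus : Type := UnitAddCircle × UnitAddCircle

namespace Torus

/-- The universal covering projection `ℝ² → T²`. -/
def proj (v : ℝ × ℝ) : Torus := ((v.1 : UnitAddCircle), (v.2 : UnitAddCircle))

/-- `f` and `g` are isotopic rel `x`: they are joined by a path of homeomorphisms (jointly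
continuous in time and space) whose values on `x` do not depend on the time. -/
def IsotopicRel (x : Set Torus) (f g : Torus ≃ₜ Torus) : Prop :=
  ∃ H : unitInterval → (Torus ≃ₜ Torus),
    Continuous (fun q : unitInterval × Torus => H q.1 q.2) ∧
    H 0 = f ∧ H 1 = g ∧ ∀ t, ∀ a ∈ x, H t a = f a

/-- `f` and `g` are isotopic. -/
def Isotopic (f g : Torus ≃ₜ Torus) : Prop := IsotopicRel ∅ f g

/-- The Dehn twist `(x, y) ↦ (x, y + x)` along the vertical closed curve (its linear
representative). -/
def dehnTwist : Torus ≃ₜ Torus where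
  toFun p := (p.1, p.2 + p.1)
  invFun p := (p.1, p.2 - p.1)
  left_inv p := by simp
  right_inv p := by simp
  continuous_toFun := by fun_prop
  continuous_invFun := by fun_prop

/-- Shear type: isotopic to one Dehn twist along a single (essential) closed curve. Such a curve
is the image of the vertical one under a homeomorphism `φ`, and the Dehn twist along it is
`φ ∘ dehnTwist ∘ φ⁻¹`. -/
def IsShear (f : Torus ≃ₜ Torus) : Prop :=
  ∃ φ : Torus ≃ₜ Torus, Isotopic f ((φ.symm.trans dehnTwist).trans φ)

/-- `x` is a periodic orbit of `f`. Its length (least period) is `x.ncard`. -/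
def IsPeriodicOrbit (f : Torus ≃ₜ Torus) (x : Set Torus) : Prop :=
  ∃ p ∈ Function.periodicPts f, x = Set.range (fun n : ℕ => f^[n] p)

/-- The orbits `(x, f)` and `(y, g)` are similar (of the same type): there is a homeomorphism `φ`
isotopic to the identity that takes `x` onto `y` and such that `φ f φ⁻¹` is isotopic to `g`
rel `y`. -/
def Similar (f : Torus ≃ₜ Torus) (x : Set Torus) (g : Torus ≃ₜ Torus) (y : Set Torus) : Prop :=
  ∃ φ : Torus ≃ₜ Torus, Isotopic φ (Homeomorph.refl Torus) ∧ φ '' x = y ∧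
    IsotopicRel y ((φ.symm.trans f).trans φ) g

/-- The orbit `(x, f)` forces the orbit `(y, g)`: whenever a homeomorphism has a periodic orbit of
the type of `(x, f)`, it also has a periodic orbit of the type of `(y, g)`. -/
def Forces (f : Torus ≃ₜ Torus) (x : Set Torus) (g : Torus ≃ₜ Torus) (y : Set Torus) : Prop :=
  ∀ (f' : Torus ≃ₜ Torus) (x' : Set Torus), IsPeriodicOrbit f' x' → Similar f x f' x' →
    ∃ y' : Set Torus, IsPeriodicOrbit f' y' ∧ Similar g y f' y'

/-- `F` is a lift of `f` to the universal cover. -/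
def IsLift (F : ℝ × ℝ → ℝ × ℝ) (f : Torus ≃ₜ Torus) : Prop :=
  Continuous F ∧ ∀ v, proj (F v) = f (proj v)

/-- An element of the lattice `ℤ² = H₁(T²)` as a vector of the plane. -/
def latticeVec (a : ℤ × ℤ) : ℝ × ℝ := ((a.1 : ℝ), (a.2 : ℝ))

/-- `(a, b)` is a pair of standard axes for `f` (`a` horizontal, `b` vertical): a basis of
`H₁(T²) = ℤ²` in which the map induced by `f` is `a ↦ a + b`, `b ↦ b`. The induced map is read off
from a lift `F` by `F (v + n) = F v + f_* n`. -/
def IsStandardAxes (f : Torus ≃ₜ Torus) (a b : ℤ × ℤ) : Prop :=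
  IsUnit (a.1 * b.2 - a.2 * b.1) ∧
  ∃ F : ℝ × ℝ → ℝ × ℝ, IsLift F f ∧
    ∀ v, F (v + latticeVec a) = F v + latticeVec (a + b) ∧
      F (v + latticeVec b) = F v + latticeVec b

/-- With respect to the standard axes `(a, b)` of `f`, the periodic orbit `x` has rotation number
`r ∈ [0, 1)`: for a lift `F` of `f`, the `p`-th iterate of `F` (`p` the length of `x`) moves a lift
of a point of `x` by `q` along the horizontal axis (and by some integer along the vertical axis),
and `r = q / p mod 1`. -/
def HasRotationNumber (f : Torus ≃ₜ Torus) (a b : ℤ × ℤ) (x : Set Torus) (r : ℚ) : Prop :=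
  ∃ F : ℝ × ℝ → ℝ × ℝ, IsLift F f ∧ ∃ z : ℝ × ℝ, proj z ∈ x ∧ ∃ q s : ℤ,
    F^[x.ncard] z = z + latticeVec (q • a + s • b) ∧ r = Int.fract ((q : ℚ) / (x.ncard : ℚ))

/-- The orbits `(x, f)` and `(y, g)` have the same rotation number with respect to common standard
axes. -/
def SameRotationNumber (f : Torus ≃ₜ Torus) (x : Set Torus) (g : Torus ≃ₜ Torus)
    (y : Set Torus) : Prop :=
  ∃ a b : ℤ × ℤ, IsStandardAxes f a b ∧ IsStandardAxes g a b ∧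
    ∃ r : ℚ, HasRotationNumber f a b x r ∧ HasRotationNumber g a b y r

/-- Twist type: `(x, f)` does not force any orbit of different type with the same rotation
number. -/
def IsTwistType (f : Torus ≃ₜ Torus) (x : Set Torus) : Prop :=
  ∀ (g : Torus ≃ₜ Torus) (y : Set Torus), IsPeriodicOrbit g y → SameRotationNumber f x g y →
    Forces f x g y → Similar f x g y

/-- The standard graph with `N` vertical loops: the horizontal loop `y = 0` together with the
vertical loops `x = j / N`, `0 ≤ j < N`. It is homeomorphic to a circle with `N` loops attached at
`N` points, and it cuts the torus into `N` open rectangles. -/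
def stdGraph (N : ℕ) : Set Torus :=
  {p | p.2 = 0 ∨ ∃ j < N, p.1 = (((j : ℝ) / N : ℝ) : UnitAddCircle)}

/-- The standard punctures: the centres of the `N` rectangles cut out by `stdGraph N`. The graph
is a deformation retract of the complement of the punctures. -/
def stdPunctures (N : ℕ) : Set Torus :=
  {p | ∃ j < N, p = proj (((j : ℝ) + 1 / 2) / N, 1 / 2)}

/-- `x` is a simple orbit of `f`, with `N` the length of `x`.

* A homeomorphism `Φ` of the torus carries the standard punctures onto `x`, and so the standard
  graph onto a graph `G` which is a deformation retract of `T² \ x` and is placed in it in the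
  standard way.
* A homeomorphism `f'` isotopic to `f` rel `x` leaves a neighbourhood `U ⊆ T² \ x` of `G`
  invariant, and the action it induces on `G` is this: `f'` restricted to `G` is homotopic in `U`
  to a map `G → G` that takes each vertical loop to the one `k` places further along the
  horizontal loop, and takes each edge of the horizontal loop to the edge `k` places further,
  except for one edge (number `i`), whose image first runs once around a vertical loop
  and then along the edge `k` places further. -/
def IsSimpleOrbit (f : Torus ≃ₜ Torus) (x : Set Torus) : Prop :=
  IsPeriodicOrbit f x ∧
  ∃ Φ : Torus ≃ₜ Torus, Φ '' stdPunctures x.ncard = x ∧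
  ∃ f' : Torus ≃ₜ Torus, IsotopicRel x f f' ∧
  ∃ U : Set Torus, IsOpen U ∧ Φ '' stdGraph x.ncard ⊆ U ∧ Disjoint U x ∧ f' '' U = U ∧
  ∃ k < x.ncard, ∃ i < x.ncard, ∃ H : unitInterval → Torus → Torus,
    ContinuousOn (fun q : unitInterval × Torus => H q.1 q.2)
      (Set.univ ×ˢ stdGraph x.ncard) ∧
    (∀ t, ∀ p ∈ stdGraph x.ncard, H t p ∈ U) ∧
    (∀ p ∈ stdGraph x.ncard, H 0 p = f' (Φ p)) ∧
    -- vertical loops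
    (∀ j < x.ncard, ∀ s : ℝ,
      H 1 (proj ((j : ℝ) / x.ncard, s)) = Φ (proj (((j : ℝ) + k) / x.ncard, s))) ∧
    -- horizontal edges without twist
    (∀ j < x.ncard, j ≠ i → ∀ t ∈ Set.Icc (0 : ℝ) 1,
      H 1 (proj (((j : ℝ) + t) / x.ncard, 0)) = Φ (proj (((j : ℝ) + k + t) / x.ncard, 0))) ∧
    -- the horizontal edge with the twist: first around the vertical loop, then along the edge
    (∀ t ∈ Set.Icc (0 : ℝ) (1 / 2),
      H 1 (proj (((i : ℝ) + t) / x.ncard, 0)) = Φ (proj (((i : ℝ) + k) / x.ncard, 2 * t))) ∧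
    (∀ t ∈ Set.Icc (1 / 2 : ℝ) 1,
      H 1 (proj (((i : ℝ) + t) / x.ncard, 0)) =
        Φ (proj (((i : ℝ) + k + (2 * t - 1)) / x.ncard, 0)))

end Torus

section

open unitInterval

/-! The example is a skew product over a circle map, seen in other coordinates. The circle map moves
every point by at least 1/2, with equality only at 1/4 and 3/4, which it interchanges and which are
its only periodic points. The fibre rotation is a half-turn after one passage over both circles x =
1/4 and x = 3/4, so every periodic orbit has period 4 and the square has no fixed point. Vertical
translations commute with the map, are isotopic to the identity and act transitively on its periodic
orbits. Hence every periodic orbit has the type of `x`, and `x` can force nothing else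
(`similar_of_forces`); twist type is a special case.

The orbit is not simple for arithmetic reasons. In a simple orbit of length N, the map lifts to a
shift of the N columns between vertical loops by a constant κ, and N times the rotation number is ±κ
mod N (`exists_shift_of_homotopy`, `IsSimpleOrbit.not_dvd`). As the points are permuted in one
cycle, κ must be prime to N. Here N = 4 and the lift advances by 2. That columns really go to
columns, although only the graph is controlled, is a winding number argument: a puncture cannot
change sides of a vertical line that is deformed off it (`fst_lt_of_homotopy`). -/

instance : ContractibleSpace I :=
  (convex_Icc (0 : ℝ) 1).contractibleSpace ⟨0, by simp⟩

/-- Together with contractibility this makes the lifting criterion for coverings available on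
products of `I` with a line or a plane. -/
instance : LocallyPathConnectedSpace I :=
  (isQuotientMap_projIcc (h := zero_le_one' ℝ)).locallyPathConnectedSpace

/-! ### Winding of nowhere vanishing loops in the plane -/

/-- The nowhere vanishing loop `γ` of period one winds `n` times around the origin. -/
def HasWinding (γ : ℝ → ℂ) (n : ℤ) : Prop :=
  ∃ θ : ℝ → ℂ, Continuous θ ∧ (∀ s, Complex.exp (θ s) = γ s) ∧
    ∀ s, θ (s + 1) = θ s + n * (2 * Real.pi * Complex.I)

/-- Both functions lift the same map through the covering `exp`; once corrected at one point by a
period, they agree on the connected domain. -/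
theorem Complex.exists_sub_eq_of_exp_eq {A : Type*} [TopologicalSpace A] [PreconnectedSpace A]
    [Nonempty A] {f g : A → ℂ} (hf : Continuous f) (hg : Continuous g)
    (h : ∀ a, Complex.exp (f a) = Complex.exp (g a)) :
    ∃ n : ℤ, ∀ a, f a = g a + n * (2 * Real.pi * Complex.I) := by
  obtain ⟨a₀⟩ := ‹Nonempty A›
  obtain ⟨n, hn⟩ := Complex.exp_eq_exp_iff_exists_int.1 (h a₀)
  refine ⟨n, fun a => ?_⟩
  refine congrFun (Complex.isCoveringMap_exp.eq_of_comp_eq hf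
    (g₂ := fun a => g a + n * (2 * Real.pi * Complex.I)) (by fun_prop) ?_ a₀ hn) a
  funext a
  simp only [Function.comp_apply, Subtype.mk.injEq]
  rw [h, Complex.exp_periodic.int_mul n (g a)]

theorem HasWinding.unique {γ : ℝ → ℂ} {m n : ℤ} (hm : HasWinding γ m) (hn : HasWinding γ n) :
    m = n := by
  obtain ⟨θ, hθ, hθe, hθp⟩ := hm
  obtain ⟨η, hη, hηe, hηp⟩ := hn
  obtain ⟨k, hk⟩ := Complex.exists_sub_eq_of_exp_eq hθ hη fun s => by rw [hθe, hηe]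
  have h := hk (0 + 1)
  rw [hθp, hηp, hk 0] at h
  have h' : ((m : ℂ) - n) * (2 * Real.pi * Complex.I) = 0 := by linear_combination h
  rcases mul_eq_zero.1 h' with h' | h'
  · exact_mod_cast sub_eq_zero.1 h'
  · exact absurd h' Complex.two_pi_I_ne_zero

theorem HasWinding.const {c : ℂ} (hc : c ≠ 0) : HasWinding (fun _ => c) 0 :=
  ⟨fun _ => Complex.log c, continuous_const, fun _ => Complex.exp_log hc, by simp⟩

/-- The winding number is invariant under homotopies of nowhere vanishing loops. -/
theorem HasWinding.homotopy {u : I × ℝ → ℂ} (hu : Continuous u) (h0 : ∀ q, u q ≠ 0)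
    (hper : ∀ t s, u (t, s + 1) = u (t, s)) {n : ℤ} (h : HasWinding (fun s => u (0, s)) n) :
    HasWinding (fun s => u (1, s)) n := by
  obtain ⟨θ, ⟨-, hθ⟩, -⟩ := Complex.isCoveringMapOn_exp.existsUnique_continuousMap_lifts
    (⟨u, hu⟩ : C(I × ℝ, ℂ)) (a₀ := (0, 0)) (e₀ := Complex.log (u (0, 0)))
    (Complex.exp_log (h0 _)) (fun q => h0 q)
  have hθ' : ∀ q, Complex.exp (θ q) = u q := fun q => congrFun hθ q
  -- The increment of the logarithm over a period is one integer for all times, since `I × ℝ` is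
  -- connected.
  obtain ⟨m, hm⟩ := Complex.exists_sub_eq_of_exp_eq (f := fun q : I × ℝ => θ (q.1, q.2 + 1))
    (g := fun q : I × ℝ => θ (q.1, q.2)) (by fun_prop) (by fun_prop)
    (fun q => by rw [hθ', hθ', hper])
  have w : ∀ t, HasWinding (fun s => u (t, s)) m := fun t =>
    ⟨fun s => θ (t, s), by fun_prop, fun s => hθ' _, fun s => hm (t, s)⟩
  rw [h.unique (w 0)]
  exact w 1

/-! ### Separation by images of vertical lines -/

/-- The covering of the punctured plane by the plane, with deck group generated by the vertical
unit translation. -/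
noncomputable def annulusExp (v : ℝ × ℝ) : ℂ :=
  Complex.exp (2 * Real.pi * (v.1 + v.2 * Complex.I))

theorem continuous_annulusExp : Continuous annulusExp := by unfold annulusExp; fun_prop

theorem annulusExp_ne_zero (v : ℝ × ℝ) : annulusExp v ≠ 0 := Complex.exp_ne_zero _

theorem norm_annulusExp (v : ℝ × ℝ) : ‖annulusExp v‖ = Real.exp (2 * Real.pi * v.1) := by
  simp [annulusExp, Complex.norm_exp]

theorem annulusExp_eq_iff {v w : ℝ × ℝ} :
    annulusExp v = annulusExp w ↔ ∃ n : ℤ, v = w + (0, (n : ℝ)) := by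
  have hpi : (2 * Real.pi : ℂ) ≠ 0 := by exact_mod_cast (mul_pos two_pos Real.pi_pos).ne'
  rw [annulusExp, annulusExp, Complex.exp_eq_exp_iff_exists_int]
  refine exists_congr fun n => ⟨fun h => ?_, fun h => ?_⟩
  · have h' : (v.1 : ℂ) + v.2 * Complex.I = w.1 + (w.2 + n) * Complex.I :=
      mul_left_cancel₀ hpi (by linear_combination h)
    have h1 := congrArg Complex.re h'
    have h2 := congrArg Complex.im h'
    simp at h1 h2
    exact Prod.ext (by simpa using h1) (by simpa using h2)
  · rw [h]
    simp
    ring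

theorem annulusExp_add_vertical (v : ℝ × ℝ) : annulusExp (v + (0, 1)) = annulusExp v :=
  annulusExp_eq_iff.2 ⟨1, by simp⟩

theorem hasWinding_annulusExp {γ : ℝ → ℝ × ℝ} (hγ : Continuous γ)
    (hper : ∀ s, γ (s + 1) = γ s + (0, 1)) : HasWinding (fun s => annulusExp (γ s)) 1 :=
  ⟨fun s => 2 * Real.pi * ((γ s).1 + (γ s).2 * Complex.I), by fun_prop, fun _ => rfl, fun s => by
    simp [hper]; ring⟩

/-- A periodic vertical curve winds once about every point that lies to the left of it. -/
theorem hasWinding_annulusExp_sub {γ : ℝ → ℝ × ℝ} (hγ : Continuous γ)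
    (hper : ∀ s, γ (s + 1) = γ s + (0, 1)) {w : ℝ × ℝ} (hw : ∀ s, w.1 < (γ s).1) :
    HasWinding (fun s => annulusExp (γ s) - annulusExp w) 1 := by
  -- Shrink the point to the origin: its modulus grows with the abscissa of `w`, so it stays below
  -- that of the curve throughout.
  have h := HasWinding.homotopy
    (u := fun q : I × ℝ => annulusExp (γ q.2) - ((q.1 : ℝ) : ℂ) * annulusExp w) (n := 1)
    (by have := continuous_annulusExp; fun_prop)
    (fun q hq => by
      have h1 := congrArg norm (sub_eq_zero.1 hq)
      rw [norm_mul, norm_annulusExp, norm_annulusExp, Complex.norm_real, Real.norm_eq_abs,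
        abs_of_nonneg q.1.2.1] at h1
      have h2 : Real.exp (2 * Real.pi * w.1) < Real.exp (2 * Real.pi * (γ q.2).1) :=
        Real.exp_lt_exp.2 (mul_lt_mul_of_pos_left (hw _) (mul_pos two_pos Real.pi_pos))
      have h3 := mul_le_of_le_one_left (Real.exp_pos (2 * Real.pi * w.1)).le q.1.2.2
      linarith)
    (fun t s => by simp only [hper, annulusExp_add_vertical])
    (by simpa using hasWinding_annulusExp hγ hper)
  simpa using h

/-- A periodic vertical curve does not wind about a point that lies to the right of it. -/
theorem hasWinding_annulusExp_sub_of_lt {γ : ℝ → ℝ × ℝ} (hγ : Continuous γ)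
    (hper : ∀ s, γ (s + 1) = γ s + (0, 1)) {w : ℝ × ℝ} (hw : ∀ s, (γ s).1 < w.1) :
    HasWinding (fun s => annulusExp (γ s) - annulusExp w) 0 := by
  -- Now it is the curve that is shrunk to the origin, where the difference is constant.
  have h := HasWinding.homotopy
    (u := fun q : I × ℝ => ((q.1 : ℝ) : ℂ) * annulusExp (γ q.2) - annulusExp w) (n := 0)
    (by have := continuous_annulusExp; fun_prop)
    (fun q hq => by
      have h1 := congrArg norm (sub_eq_zero.1 hq)
      rw [norm_mul, norm_annulusExp, norm_annulusExp, Complex.norm_real, Real.norm_eq_abs,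
        abs_of_nonneg q.1.2.1] at h1
      have h2 : Real.exp (2 * Real.pi * (γ q.2).1) < Real.exp (2 * Real.pi * w.1) :=
        Real.exp_lt_exp.2 (mul_lt_mul_of_pos_left (hw _) (mul_pos two_pos Real.pi_pos))
      have h3 := mul_le_of_le_one_left (Real.exp_pos (2 * Real.pi * (γ q.2).1)).le q.1.2.2
      linarith)
    (fun t s => by simp only [hper, annulusExp_add_vertical])
    (by simpa using HasWinding.const (neg_ne_zero.2 (annulusExp_ne_zero w)))
  simpa using h

theorem bddBelow_fst_of_periodic {γ : ℝ → ℝ × ℝ} (hγ : Continuous γ)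
    (hper : ∀ s, γ (s + 1) = γ s + (0, 1)) : ∃ C : ℝ, ∀ s, C < (γ s).1 := by
  have hp : Function.Periodic (fun s => (γ s).1) 1 := fun s => by simp [hper]
  obtain ⟨C, hC⟩ := (isCompact_Icc (a := (0 : ℝ)) (b := 1)).bddBelow_image
    (f := fun s => (γ s).1) (by fun_prop)
  refine ⟨C - 1, fun s => ?_⟩
  obtain ⟨y, hy, hys⟩ := hp.exists_mem_Ico₀ one_pos s
  have := hC ⟨y, ⟨hy.1, hy.2.le⟩, rfl⟩
  rw [hys]
  linarith

theorem map_add_zsmul_of_map_add {A B : Type*} [AddCommGroup A] [AddCommGroup B] {F : A → B}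
    {a : A} {b : B} (h : ∀ v, F (v + a) = F v + b) (n : ℤ) (v : A) :
    F (v + n • a) = F v + n • b := by
  induction n using Int.induction_on generalizing v with
  | zero => simp
  | succ n ih => rw [add_zsmul, one_zsmul, ← add_assoc, h, ih, add_zsmul, one_zsmul, add_assoc]
  | pred n ih =>
    have h1 := h (v + (-(n : ℤ) - 1) • a)
    rw [add_assoc, ← add_one_zsmul, sub_add_cancel, ih] at h1
    rw [← add_right_cancel_iff (a := b), ← h1, add_assoc, ← add_one_zsmul, sub_add_cancel]

/-- Let `F` be an injective self-map of the plane that acts on the lattice by a shear, and let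
the image of the vertical line `x = a` be homotopic to the line `x = c` off the vertical
translates of `F p`. If `p` is to the left of `x = a` then `F p` is to the left of `x = c`. -/
theorem fst_lt_of_homotopy {F : ℝ × ℝ → ℝ × ℝ} (hF : Continuous F) (hinj : Function.Injective F)
    (hv : ∀ v, F (v + (0, 1)) = F v + (0, 1)) (hh : ∀ v, F (v + (1, 0)) = F v + (1, 1))
    {a c d : ℝ} {p : ℝ × ℝ} (hp : p.1 < a) {V : I × ℝ → ℝ × ℝ} (hV : Continuous V)
    (hV0 : ∀ s, V (0, s) = F (a, s)) (hVp : ∀ t s, V (t, s + 1) = V (t, s) + (0, 1))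
    (hV1 : ∀ s, V (1, s) = (c, s + d)) (havoid : ∀ q, ∀ n : ℤ, V q ≠ F p + (0, (n : ℝ))) :
    (F p).1 < c := by
  have hvn : ∀ (n : ℤ) v, F (v + (0, (n : ℝ))) = F v + (0, (n : ℝ)) := fun n v => by
    simpa using map_add_zsmul_of_map_add hv n v
  have hhn : ∀ (n : ℕ) v, (F (v - ((n : ℝ), 0))).1 = (F v).1 - n := fun n v => by
    have := map_add_zsmul_of_map_add hh (-n) v
    rw [show v - ((n : ℝ), (0 : ℝ)) = v + (-n : ℤ) • ((1 : ℝ), (0 : ℝ)) by ext <;> simp; ring,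
      this]
    simp
    ring
  have hγ : Continuous fun s => F (a, s) := by fun_prop
  have hγp : ∀ s, F (a, s + 1) = F (a, s) + (0, 1) := fun s => by rw [← hv]; simp
  obtain ⟨C, hC⟩ := bddBelow_fst_of_periodic hγ hγp
  -- Moving `p` left by `R` moves its image left by `R`, which puts it to the left of the whole
  -- curve, where the winding number is known.
  obtain ⟨R, hR⟩ := exists_nat_gt ((F p).1 - C)
  have w1 : HasWinding (fun s => annulusExp (F (a, s)) - annulusExp (F (p - ((R : ℝ), 0)))) 1 :=
    hasWinding_annulusExp_sub hγ hγp fun s => by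
      rw [hhn]
      linarith [hC s]
  -- Slide the point back to `p` along a horizontal segment. The segment and its vertical translates
  -- stay left of x = a, so by injectivity their images miss the image of that line.
  have w2 : HasWinding (fun s => annulusExp (F (a, s)) - annulusExp (F p)) 1 := by
    have h := HasWinding.homotopy (u := fun q : I × ℝ => annulusExp (F (a, q.2)) -
        annulusExp (F (p - ((1 - (q.1 : ℝ)) * R, 0)))) (n := 1)
      (by have := continuous_annulusExp; fun_prop)
      (fun q hq => by
        obtain ⟨n, hn⟩ := annulusExp_eq_iff.1 (sub_eq_zero.1 hq)
        rw [← hvn] at hn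
        have h1 := congrArg Prod.fst (hinj hn)
        simp at h1
        have : 0 ≤ (1 - (q.1 : ℝ)) * R := mul_nonneg (by linarith [q.1.2.2]) R.cast_nonneg
        linarith)
      (fun t s => by simp only [hγp, annulusExp_add_vertical])
      (by simpa using w1)
    simpa [← Prod.zero_eq_mk] using h
  -- The homotopy `V` avoids all vertical translates of `F p`, so the winding number survives to the
  -- straight line.
  have w3 : HasWinding (fun s => annulusExp (c, s + d) - annulusExp (F p)) 1 := by
    have h := HasWinding.homotopy (u := fun q : I × ℝ => annulusExp (V q) - annulusExp (F p))
      (n := 1) (by have := continuous_annulusExp; fun_prop)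
      (fun q hq => by
        obtain ⟨n, hn⟩ := annulusExp_eq_iff.1 (sub_eq_zero.1 hq)
        exact havoid q n hn)
      (fun t s => by simp only [hVp, annulusExp_add_vertical])
      (by simpa [hV0] using w2)
    simpa [hV1] using h
  rcases lt_trichotomy (F p).1 c with h | h | h
  · exact h
  · refine absurd ?_ (havoid (1, (F p).2 - d) 0)
    rw [hV1]
    ext <;> simp [h]
  · have w4 : HasWinding (fun s => annulusExp (c, s + d) - annulusExp (F p)) 0 :=
      hasWinding_annulusExp_sub_of_lt (γ := fun s => (c, s + d)) (by fun_prop)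
        (fun s => by ext <;> simp; ring) (fun _ => h)
    exact absurd (w3.unique w4) (by norm_num)

/-- Conjugation by v ↦ -v preserves both lattice relations and exchanges left and right; reversing
`s` keeps the period of `V` upward. -/
theorem lt_fst_of_homotopy {F : ℝ × ℝ → ℝ × ℝ} (hF : Continuous F) (hinj : Function.Injective F)
    (hv : ∀ v, F (v + (0, 1)) = F v + (0, 1)) (hh : ∀ v, F (v + (1, 0)) = F v + (1, 1))
    {a c d : ℝ} {p : ℝ × ℝ} (hp : a < p.1) {V : I × ℝ → ℝ × ℝ} (hV : Continuous V)
    (hV0 : ∀ s, V (0, s) = F (a, s)) (hVp : ∀ t s, V (t, s + 1) = V (t, s) + (0, 1))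
    (hV1 : ∀ s, V (1, s) = (c, s + d)) (havoid : ∀ q, ∀ n : ℤ, V q ≠ F p + (0, (n : ℝ))) :
    c < (F p).1 := by
  have h := fst_lt_of_homotopy (F := fun v => -F (-v)) (a := -a) (c := -c) (d := -d) (p := -p)
    (V := fun q => -V (q.1, -q.2)) (by fun_prop)
    (fun v w hvw => neg_injective (hinj (neg_injective hvw)))
    (fun v => by
      have := hv (-(v + (0, 1)))
      rw [show -(v + ((0 : ℝ), (1 : ℝ))) + (0, 1) = -v by abel] at this
      rw [this]; abel)
    (fun v => by
      have := hh (-(v + (1, 0)))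
      rw [show -(v + ((1 : ℝ), (0 : ℝ))) + (1, 0) = -v by abel] at this
      rw [this]; abel)
    (by simpa using hp) (by fun_prop) (fun s => by simp [hV0])
    (fun t s => by
      have := hVp t (-(s + 1))
      rw [show -(s + 1) + 1 = -s by ring] at this
      simp only [this]; abel)
    (fun s => by simp [hV1]; ring)
    (fun q n hq => havoid (q.1, -q.2) (-n) (by
      have := congrArg Neg.neg hq
      simpa [add_comm, ← sub_eq_add_neg] using this))
  simpa using h

namespace Torus

/-! ### Lifts to the universal cover -/

theorem continuous_proj : Continuous proj :=
  ((AddCircle.continuous_mk' 1).comp continuous_fst).prodMk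
    ((AddCircle.continuous_mk' 1).comp continuous_snd)

theorem coe_eq_coe_iff {x y : ℝ} : (x : UnitAddCircle) = y ↔ ∃ n : ℤ, x = y + n := by
  rw [← sub_eq_zero, ← AddCircle.coe_sub, AddCircle.coe_eq_zero_iff]
  exact exists_congr fun n => by rw [zsmul_eq_mul, mul_one, eq_comm, sub_eq_iff_eq_add']

theorem proj_eq_iff {v w : ℝ × ℝ} : proj v = proj w ↔ ∃ n : ℤ × ℤ, v = w + latticeVec n := by
  simp only [proj, coe_eq_coe_iff, latticeVec, Prod.ext_iff, Prod.exists,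
    Prod.fst_add, Prod.snd_add, exists_and_left, exists_and_right]

theorem proj_surjective : Function.Surjective proj := by
  rintro ⟨a, b⟩
  obtain ⟨x, rfl⟩ := QuotientAddGroup.mk_surjective a
  obtain ⟨y, rfl⟩ := QuotientAddGroup.mk_surjective b
  exact ⟨(x, y), rfl⟩

theorem proj_add_latticeVec (v : ℝ × ℝ) (n : ℤ × ℤ) : proj (v + latticeVec n) = proj v :=
  proj_eq_iff.2 ⟨n, rfl⟩

theorem latticeVec_injective : Function.Injective latticeVec := fun m n h => by
  have h1 := congrArg Prod.fst h
  have h2 := congrArg Prod.snd h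
  simp only [latticeVec, Int.cast_inj] at h1 h2
  exact Prod.ext h1 h2

variable {A : Type*} [TopologicalSpace A]

theorem exists_lift [SimplyConnectedSpace A] [LocallyPathConnectedSpace A] {g : A → Torus}
    (hg : Continuous g) (a : A) (v : ℝ × ℝ) (h : proj v = g a) :
    ∃ G : A → ℝ × ℝ, Continuous G ∧ (∀ b, proj (G b) = g b) ∧ G a = v := by
  have cov := AddCircle.isCoveringMap_coe (1 : ℝ)
  obtain ⟨G₁, ⟨h1, h1'⟩, -⟩ := cov.existsUnique_continuousMap_lifts
    (⟨fun b => (g b).1, by fun_prop⟩ : C(A, UnitAddCircle)) a v.1 (congrArg Prod.fst h)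
  obtain ⟨G₂, ⟨h2, h2'⟩, -⟩ := cov.existsUnique_continuousMap_lifts
    (⟨fun b => (g b).2, by fun_prop⟩ : C(A, UnitAddCircle)) a v.2 (congrArg Prod.snd h)
  exact ⟨fun b => (G₁ b, G₂ b), by fun_prop,
    fun b => Prod.ext (congrFun h1' b) (congrFun h2' b), Prod.ext h1 h2⟩

theorem lift_unique [PreconnectedSpace A] {G₁ G₂ : A → ℝ × ℝ} (h₁ : Continuous G₁)
    (h₂ : Continuous G₂) (h : ∀ a, proj (G₁ a) = proj (G₂ a)) (a : A) (ha : G₁ a = G₂ a) :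
    G₁ = G₂ := by
  have cov := AddCircle.isCoveringMap_coe (1 : ℝ)
  have e1 := cov.eq_of_comp_eq (g₁ := fun b => (G₁ b).1) (g₂ := fun b => (G₂ b).1)
    (by fun_prop) (by fun_prop) (funext fun b => congrArg Prod.fst (h b)) a (by rw [ha])
  have e2 := cov.eq_of_comp_eq (g₁ := fun b => (G₁ b).2) (g₂ := fun b => (G₂ b).2)
    (by fun_prop) (by fun_prop) (funext fun b => congrArg Prod.snd (h b)) a (by rw [ha])
  exact funext fun b => Prod.ext (congrFun e1 b) (congrFun e2 b)

theorem exists_eq_add_latticeVec [PreconnectedSpace A] [Nonempty A] {G₁ G₂ : A → ℝ × ℝ}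
    (h₁ : Continuous G₁) (h₂ : Continuous G₂) (h : ∀ a, proj (G₁ a) = proj (G₂ a)) :
    ∃ n : ℤ × ℤ, ∀ a, G₁ a = G₂ a + latticeVec n := by
  obtain ⟨a⟩ := ‹Nonempty A›
  obtain ⟨n, hn⟩ := proj_eq_iff.1 (h a)
  exact ⟨n, congrFun (lift_unique h₁ (G₂ := fun b => G₂ b + latticeVec n) (by fun_prop)
    (fun b => by rw [h, proj_add_latticeVec]) a hn)⟩

/-- Two curves with the same projection have the same displacement. -/
theorem sub_eq_sub_of_proj_eq {G₁ G₂ : ℝ → ℝ × ℝ} (h₁ : Continuous G₁) (h₂ : Continuous G₂)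
    {a b : ℝ} (hab : a ≤ b) (h : ∀ t ∈ Set.Icc a b, proj (G₁ t) = proj (G₂ t)) :
    G₁ b - G₁ a = G₂ b - G₂ a := by
  have : Nonempty (Set.Icc a b) := ⟨⟨a, le_rfl, hab⟩⟩
  have : PreconnectedSpace (Set.Icc a b) := Subtype.preconnectedSpace isPreconnected_Icc
  obtain ⟨n, hn⟩ := exists_eq_add_latticeVec (A := Set.Icc a b) (G₁ := fun t => G₁ t)
    (G₂ := fun t => G₂ t) (by fun_prop) (by fun_prop) (fun t => h t t.2)
  rw [hn ⟨a, le_rfl, hab⟩, hn ⟨b, hab, le_rfl⟩]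
  abel

theorem exists_isLift (f : Torus ≃ₜ Torus) : ∃ F, IsLift F f := by
  obtain ⟨v, hv⟩ := proj_surjective (f (proj 0))
  obtain ⟨F, hF, h, -⟩ := exists_lift (f.continuous.comp continuous_proj) 0 v hv
  exact ⟨F, hF, h⟩

theorem IsLift.exists_add_latticeVec {f : Torus ≃ₜ Torus} {F : ℝ × ℝ → ℝ × ℝ} (hF : IsLift F f)
    (n : ℤ × ℤ) : ∃ m : ℤ × ℤ, ∀ v, F (v + latticeVec n) = F v + latticeVec m := by
  have hc := hF.1
  exact exists_eq_add_latticeVec (by fun_prop) hc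
    fun v => by rw [hF.2, hF.2, proj_add_latticeVec]

/-- Every homeomorphism of the torus lifts to a homeomorphism of the plane. -/
theorem exists_isLift_inverse (f : Torus ≃ₜ Torus) :
    ∃ P Q, IsLift P f ∧ IsLift Q f.symm ∧ (∀ v, Q (P v) = v) ∧ ∀ v, P (Q v) = v := by
  obtain ⟨P, hP⟩ := exists_isLift f
  -- Normalising `Q` to send `P 0` to 0 makes both composites lifts of the identity with a fixed
  -- point.
  obtain ⟨Q, hQ, hQ', hQ0⟩ := exists_lift (f.symm.continuous.comp continuous_proj) (P 0) 0
    (by simp [hP.2])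
  have hPc := hP.1
  have e1 : ∀ v, Q (P v) = v := congrFun (lift_unique (by fun_prop) continuous_id
    (fun v => by simp [hQ', hP.2]) 0 hQ0)
  exact ⟨P, Q, hP, ⟨hQ, hQ'⟩, e1, congrFun (lift_unique (by fun_prop) continuous_id
    (fun v => by simp [hQ', hP.2]) (P 0) (by simp [hQ0]))⟩

theorem IsLift.injective {f : Torus ≃ₜ Torus} {F : ℝ × ℝ → ℝ × ℝ} (hF : IsLift F f) :
    Function.Injective F := by
  obtain ⟨P, Q, hP, hQ, hQP, -⟩ := exists_isLift_inverse f
  obtain ⟨n, hn⟩ := exists_eq_add_latticeVec hF.1 hP.1 fun v => by rw [hF.2, hP.2]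
  intro v w hvw
  rw [hn, hn, add_right_cancel_iff] at hvw
  rw [← hQP v, hvw, hQP]

/-- An isotopy rel `x` lifts: the lift at the end agrees with the given lift at the beginning on
the preimage of `x`, and has the same action on the lattice. -/
theorem IsotopicRel.exists_isLift {x : Set Torus} {f f' : Torus ≃ₜ Torus} (h : IsotopicRel x f f')
    {F : ℝ × ℝ → ℝ × ℝ} (hF : IsLift F f) :
    ∃ F', IsLift F' f' ∧ (∀ z, proj z ∈ x → F' z = F z) ∧
      ∀ n m : ℤ × ℤ, (∀ v, F (v + latticeVec n) = F v + latticeVec m) →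
        ∀ v, F' (v + latticeVec n) = F' v + latticeVec m := by
  obtain ⟨H, hH, hH0, hH1, hx⟩ := h
  have hFc := hF.1
  obtain ⟨G, hG, hG', hG0⟩ := exists_lift (g := fun q : I × (ℝ × ℝ) => H q.1 (proj q.2))
    (hH.comp (continuous_fst.prodMk (continuous_proj.comp continuous_snd))) (0, 0) (F 0)
    (by simp [hF.2, hH0])
  have hGF : ∀ v, G (0, v) = F v := congrFun (lift_unique (by fun_prop) hF.1
    (fun v => by simp [hG', hF.2, hH0]) 0 hG0)
  refine ⟨fun v => G (1, v), ⟨by fun_prop, fun v => by simp [hG', hH1]⟩, fun z hz => ?_,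
    fun n m hnm v => ?_⟩
  -- Over a point of `x` the track of the isotopy projects to a constant, so it is constant.
  · exact congrFun (lift_unique (G₁ := fun t => G (t, z)) (G₂ := fun _ => F z) (by fun_prop)
      (by fun_prop) (fun t => by simp [hG', hF.2, hx t _ hz]) 0 (hGF z)) 1
  · exact congrFun (lift_unique (G₁ := fun q : I × (ℝ × ℝ) => G (q.1, q.2 + latticeVec n))
      (G₂ := fun q => G q + latticeVec m) (by fun_prop) (by fun_prop)
      (fun q => by simp [hG', proj_add_latticeVec]) (0, 0) (by rw [hGF, hGF, hnm])) (1, v)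

/-! ### Simple orbits -/

theorem add_latticeVec_of_shear {K : ℝ × ℝ → ℝ × ℝ} (hv : ∀ v, K (v + (0, 1)) = K v + (0, 1))
    (hh : ∀ v, K (v + (1, 0)) = K v + (1, 1)) (m n : ℤ) (v : ℝ × ℝ) :
    K (v + latticeVec (m, n)) = K v + latticeVec (m, m + n) := by
  have e : latticeVec (m, n) = m • ((1 : ℝ), (0 : ℝ)) + n • ((0 : ℝ), (1 : ℝ)) := by
    ext <;> simp [latticeVec]
  rw [e, ← add_assoc, map_add_zsmul_of_map_add hv, map_add_zsmul_of_map_add hh]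
  ext <;> simp [latticeVec, add_assoc]

theorem proj_horizontal_mem_stdGraph (N : ℕ) (s : ℝ) : proj (s, 0) ∈ stdGraph N := Or.inl rfl

/-- The value j = N is the loop x = 0 again; it serves as the right-hand wall of the last column. -/
theorem proj_vertical_mem_stdGraph {N j : ℕ} (hN : 0 < N) (hj : j ≤ N) (s : ℝ) :
    proj ((j : ℝ) / N, s) ∈ stdGraph N := by
  rcases hj.lt_or_eq with h | rfl
  · exact Or.inr ⟨j, h, rfl⟩
  · refine Or.inr ⟨0, hN, ?_⟩
    have : (j : ℝ) ≠ 0 := by positivity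
    simp [proj, this]

theorem exists_eq_add_mul {N : ℕ} (hN : 0 < N) (a : ℤ) :
    ∃ j < N, (a : ℝ) = j + N * (a / N : ℤ) := by
  have hN0 : (N : ℤ) ≠ 0 := by exact_mod_cast hN.ne'
  obtain ⟨j, hj⟩ := Int.eq_ofNat_of_zero_le (Int.emod_nonneg a hN0)
  have h1 := Int.emod_lt_of_pos a (by exact_mod_cast hN : (0 : ℤ) < N)
  have h2 := Int.emod_add_mul_ediv a N
  rw [hj] at h2
  exact ⟨j, by omega, by exact_mod_cast h2.symm⟩

theorem proj_mem_stdPunctures_iff {N : ℕ} (hN : 0 < N) {v : ℝ × ℝ} :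
    proj v ∈ stdPunctures N ↔ ∃ a b : ℤ, v = (((a : ℝ) + 1 / 2) / N, (b : ℝ) + 1 / 2) := by
  have hN' : (N : ℝ) ≠ 0 := by positivity
  constructor
  · rintro ⟨j, -, h⟩
    obtain ⟨n, rfl⟩ := proj_eq_iff.1 h
    refine ⟨j + N * n.1, n.2, ?_⟩
    ext <;> simp [latticeVec]
    · field_simp; ring
    · ring
  · rintro ⟨a, b, rfl⟩
    obtain ⟨j, hj, ha⟩ := exists_eq_add_mul hN a
    refine ⟨j, hj, proj_eq_iff.2 ⟨(a / N, b), ?_⟩⟩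
    rw [ha]
    ext <;> simp [latticeVec]
    · field_simp; ring
    · ring

/-- The homotopy class of the map that a homeomorphism `g` induces on the standard graph of a
simple orbit determines a lift of `g` on the lifted punctures, up to vertical translations. -/
theorem exists_shift_of_homotopy {N k i : ℕ} (hN : 0 < N) (hi : i < N) {g : Torus ≃ₜ Torus}
    {K : ℝ × ℝ → ℝ × ℝ} (hK : IsLift K g) (hg : ∀ p ∈ stdPunctures N, g p ∈ stdPunctures N)
    {H : I → Torus → Torus}
    (hH : ContinuousOn (fun q : I × Torus => H q.1 q.2) (Set.univ ×ˢ stdGraph N))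
    (hHP : ∀ t, ∀ p ∈ stdGraph N, H t p ∉ stdPunctures N)
    (hH0 : ∀ p ∈ stdGraph N, H 0 p = g p)
    (hvert : ∀ j < N, ∀ s : ℝ, H 1 (proj ((j : ℝ) / N, s)) = proj (((j : ℝ) + k) / N, s))
    (hhor : ∀ j < N, j ≠ i → ∀ t ∈ Set.Icc (0 : ℝ) 1,
      H 1 (proj (((j : ℝ) + t) / N, 0)) = proj (((j : ℝ) + k + t) / N, 0))
    (htwist : ∀ t ∈ Set.Icc (0 : ℝ) (1 / 2),
      H 1 (proj (((i : ℝ) + t) / N, 0)) = proj (((i : ℝ) + k) / N, 2 * t))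
    (htwist' : ∀ t ∈ Set.Icc (1 / 2 : ℝ) 1,
      H 1 (proj (((i : ℝ) + t) / N, 0)) = proj (((i : ℝ) + k + (2 * t - 1)) / N, 0)) :
    (∀ v, K (v + (0, 1)) = K v + (0, 1)) ∧ (∀ v, K (v + (1, 0)) = K v + (1, 1)) ∧
    ∃ κ : ℤ, ∀ a b : ℤ, ∃ b' : ℤ,
      K (((a : ℝ) + 1 / 2) / N, (b : ℝ) + 1 / 2) = (((a : ℝ) + κ + 1 / 2) / N, (b' : ℝ) + 1 / 2) := by
  have hN' : (N : ℝ) ≠ 0 := by positivity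
  have hKc := hK.1
  have hvert' : ∀ j ≤ N, ∀ s : ℝ, H 1 (proj ((j : ℝ) / N, s)) = proj (((j : ℝ) + k) / N, s) := by
    intro j hj s
    rcases hj.lt_or_eq with h | rfl
    · exact hvert j h s
    · have e1 : proj ((j : ℝ) / j, s) = proj (((0 : ℕ) : ℝ) / j, s) :=
        proj_eq_iff.2 ⟨(1, 0), by simp [latticeVec, hN']⟩
      rw [e1, hvert 0 hN]
      exact proj_eq_iff.2 ⟨(-1, 0), by simp [latticeVec]; field_simp; ring⟩
  -- the lifted homotopy on the horizontal line
  obtain ⟨G, hG, hGp, hG00⟩ := exists_lift (g := fun q : I × ℝ => H q.1 (proj (q.2, 0)))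
    (hH.comp_continuous (f := fun q : I × ℝ => (q.1, proj (q.2, 0)))
      (continuous_fst.prodMk (continuous_proj.comp (by fun_prop)))
      fun q => ⟨trivial, proj_horizontal_mem_stdGraph N q.2⟩)
    (0, 0) (K (0, 0)) (by
      simp only [hK.2]
      exact (hH0 _ (proj_horizontal_mem_stdGraph N 0)).symm)
  have hG0 : ∀ s, G (0, s) = K (s, 0) := congrFun (lift_unique (by fun_prop) (by fun_prop)
    (fun s => by
      simp only [hGp, hK.2]
      exact hH0 _ (proj_horizontal_mem_stdGraph N s)) 0 hG00)
  -- the lifted homotopies on the vertical lines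
  have hV : ∀ j ≤ N, ∃ V : I × ℝ → ℝ × ℝ, Continuous V ∧
      (∀ q, proj (V q) = H q.1 (proj ((j : ℝ) / N, q.2))) ∧
      (∀ s, V (0, s) = K ((j : ℝ) / N, s)) ∧ (∀ t, V (t, 0) = G (t, (j : ℝ) / N)) ∧
      ∃ d : ℤ × ℤ, ∀ s, V (1, s) = (((j : ℝ) + k) / N, s) + latticeVec d := by
    intro j hj
    have hmem := proj_vertical_mem_stdGraph hN hj
    obtain ⟨V, hV, hVp, hV00⟩ := exists_lift
      (g := fun q : I × ℝ => H q.1 (proj ((j : ℝ) / N, q.2)))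
      (hH.comp_continuous (f := fun q : I × ℝ => (q.1, proj ((j : ℝ) / N, q.2)))
        (continuous_fst.prodMk (continuous_proj.comp (by fun_prop)))
        fun q => ⟨trivial, hmem q.2⟩)
      (0, 0) (K ((j : ℝ) / N, 0)) (by
        simp only [hK.2]
        exact (hH0 _ (hmem 0)).symm)
    have hV0 : ∀ s, V (0, s) = K ((j : ℝ) / N, s) := congrFun (lift_unique (by fun_prop)
      (by fun_prop) (fun s => by
        simp only [hVp, hK.2]
        exact hH0 _ (hmem s)) 0 hV00)
    refine ⟨V, hV, hVp, hV0, congrFun (lift_unique (by fun_prop) (by fun_prop)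
      (fun t => by simp only [hVp, hGp]) 0 (by rw [hV0, hG0])), ?_⟩
    exact exists_eq_add_latticeVec (G₁ := fun s => V (1, s))
      (G₂ := fun s => (((j : ℝ) + k) / N, s)) (by fun_prop) (by fun_prop)
      fun s => by simp only [hVp, hvert' j hj]
  -- Both sides lift the same homotopy, so they need only be compared at time 1, where `V` is
  -- explicit.
  have hVper : ∀ {V : I × ℝ → ℝ × ℝ} {j : ℕ}, Continuous V →
      (∀ q, proj (V q) = H q.1 (proj ((j : ℝ) / N, q.2))) →
      (∃ d : ℤ × ℤ, ∀ s, V (1, s) = (((j : ℝ) + k) / N, s) + latticeVec d) →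
      ∀ t s, V (t, s + 1) = V (t, s) + (0, 1) := by
    rintro V j hV hVp ⟨d, hd⟩ t s
    exact congrFun (lift_unique (G₁ := fun q : I × ℝ => V (q.1, q.2 + 1))
      (G₂ := fun q => V q + (0, 1)) (by fun_prop) (by fun_prop) (fun q => by
        have e : V q + (0, 1) = V q + latticeVec (0, 1) := by simp [latticeVec]
        simp only [e, proj_add_latticeVec, hVp]
        congr 1
        exact proj_eq_iff.2 ⟨(0, 1), by simp [latticeVec]⟩) (1, 0) (by
          simp only [hd]; ext <;> simp; ring)) (t, s)
  have hv : ∀ v, K (v + (0, 1)) = K v + (0, 1) := by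
    obtain ⟨V, hVc, hVp, hV0, -, hV1⟩ := hV 0 hN.le
    obtain ⟨m, hm⟩ := hK.exists_add_latticeVec (0, 1)
    have e : latticeVec (0, 1) = (0, 1) := by simp [latticeVec]
    rw [e] at hm
    have h1 := hVper hVc hVp hV1 0 0
    rw [hV0, hV0, show ((((0 : ℕ) : ℝ) / N, (0 : ℝ) + 1) : ℝ × ℝ) =
      (((0 : ℕ) : ℝ) / N, (0 : ℝ)) + (0, 1) by simp, hm, add_left_cancel_iff] at h1
    exact fun v => (hm v).trans (by rw [h1])
  -- displacement along the horizontal line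
  have hedge : ∀ j < N, G (1, ((j : ℝ) + 1) / N) - G (1, (j : ℝ) / N) =
      (1 / (N : ℝ), if j = i then 1 else 0) := by
    intro j hj
    split_ifs with hji
    · subst hji
      have h1 := sub_eq_sub_of_proj_eq (G₁ := fun t => G (1, ((j : ℝ) + t) / N))
        (G₂ := fun t => (((j : ℝ) + k) / N, 2 * t)) (a := 0) (b := 1 / 2) (by fun_prop)
        (by fun_prop) (by norm_num) fun t ht => by simp only [hGp, htwist t ht]
      have h2 := sub_eq_sub_of_proj_eq (G₁ := fun t => G (1, ((j : ℝ) + t) / N))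
        (G₂ := fun t => (((j : ℝ) + k + (2 * t - 1)) / N, 0)) (a := 1 / 2) (b := 1) (by fun_prop)
        (by fun_prop) (by norm_num) fun t ht => by simp only [hGp, htwist' t ht]
      have h3 := congrArg₂ (· + ·) h2 h1
      simp only [sub_add_sub_cancel, add_zero] at h3
      rw [h3]
      ext
      · simp; field_simp; ring
      · simp
    · have h1 := sub_eq_sub_of_proj_eq (G₁ := fun t => G (1, ((j : ℝ) + t) / N))
        (G₂ := fun t => (((j : ℝ) + k + t) / N, 0)) (a := 0) (b := 1) (by fun_prop)
        (by fun_prop) (by norm_num) fun t ht => by simp only [hGp, hhor j hj hji t ht]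
      simp only [add_zero] at h1
      rw [h1]
      ext
      · simp; field_simp; ring
      · simp
  -- The edges telescope; the twist contributes its vertical unit once, as soon as edge `i` has been
  -- passed.
  have hsum : ∀ j ≤ N, G (1, (j : ℝ) / N) - G (1, 0) =
      ((j : ℝ) / N, if i < j then 1 else 0) := by
    intro j
    induction j with
    | zero => intro; simp [← Prod.zero_eq_mk]
    | succ j ih =>
      intro hj
      have h1 := congrArg₂ (· + ·) (hedge j hj) (ih (by omega))
      simp only [sub_add_sub_cancel] at h1
      push_cast
      rw [h1]
      ext
      · simp; field_simp; ring
      · rcases lt_trichotomy i j with h | h | h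
        · simp [h.ne', h, h.trans (Nat.lt_succ_self j)]
        · simp [h]
        · simp [h.ne, not_lt.2 h.le, show ¬ i < j + 1 by omega]
  have hh : ∀ v, K (v + (1, 0)) = K v + (1, 1) := by
    obtain ⟨m, hm⟩ := hK.exists_add_latticeVec (1, 0)
    have e : latticeVec (1, 0) = (1, 0) := by simp [latticeVec]
    rw [e] at hm
    have h1 : ∀ t s, G (t, s + 1) = G (t, s) + latticeVec m := fun t s =>
      congrFun (lift_unique (G₁ := fun q : I × ℝ => G (q.1, q.2 + 1))
        (G₂ := fun q => G q + latticeVec m) (by fun_prop) (by fun_prop) (fun q => by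
          simp only [proj_add_latticeVec, hGp]
          congr 1
          exact proj_eq_iff.2 ⟨(1, 0), by simp [latticeVec]⟩) (0, 0) (by
            simp only [hG0]; rw [← hm]; simp)) (t, s)
    have h2 := hsum N le_rfl
    rw [div_self hN', if_pos hi, sub_eq_iff_eq_add', ← zero_add (1 : ℝ), h1, zero_add,
      add_left_cancel_iff] at h2
    exact fun v => (hm v).trans (by rw [h2])
  -- the images of the punctures are squeezed between the images of the vertical lines
  obtain ⟨c, hc⟩ : ∃ c : ℤ, (G (1, 0)).1 = (k : ℝ) / N + c := by
    obtain ⟨V, -, -, -, hVG, d, hd⟩ := hV 0 hN.le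
    refine ⟨d.1, ?_⟩
    have := congrArg Prod.fst ((hVG 1).symm.trans (hd 0))
    simpa [latticeVec] using this
  have hsqueeze : ∀ j < N, K (((j : ℤ) + 1 / 2 : ℝ) / N, (0 : ℤ) + 1 / 2) ∈
      {w : ℝ × ℝ | ∃ b' : ℤ, w = (((j : ℤ) + (k + N * c : ℤ) + 1 / 2 : ℝ) / N, (b' : ℝ) + 1 / 2)} := by
    intro j hj
    set p : ℝ × ℝ := (((j : ℤ) + 1 / 2 : ℝ) / N, (0 : ℤ) + 1 / 2) with hp
    have hKp : proj (K p) ∈ stdPunctures N := by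
      rw [hK.2]
      exact hg _ ((proj_mem_stdPunctures_iff hN).2 ⟨_, _, hp⟩)
    have havoid : ∀ {V : I × ℝ → ℝ × ℝ} {j : ℕ}, j ≤ N →
        (∀ q, proj (V q) = H q.1 (proj ((j : ℝ) / N, q.2))) →
        ∀ q, ∀ n : ℤ, V q ≠ K p + (0, (n : ℝ)) := by
      intro V j hj hVp q n hq
      refine hHP q.1 _ (proj_vertical_mem_stdGraph hN hj q.2) ?_
      rw [← hVp, hq, show ((0 : ℝ), (n : ℝ)) = latticeVec (0, n) by simp [latticeVec],
        proj_add_latticeVec]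
      exact hKp
    have hfst : ∀ {V : I × ℝ → ℝ × ℝ} {j : ℕ}, j ≤ N → (∀ t, V (t, 0) = G (t, (j : ℝ) / N)) →
        ∀ d : ℤ × ℤ, (∀ s, V (1, s) = (((j : ℝ) + k) / N, s) + latticeVec d) →
        ∀ s, V (1, s) = (((j : ℝ) + k) / N + c, s + d.2) := by
      intro V j hj hVG d hd s
      -- Each lifted vertical line is attached to the single lifted horizontal line `G`, so the
      -- integer `c` is the same for all of them.
      have h1 := congrArg Prod.fst (hsum j hj)
      rw [← hVG, hd] at h1
      have h2 : (d.1 : ℝ) = c := by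
        simp [latticeVec, hc] at h1
        rw [add_div] at h1
        linarith
      rw [hd]
      ext <;> simp [latticeVec, h2]
    obtain ⟨a, b, hab⟩ := (proj_mem_stdPunctures_iff hN).1 hKp
    -- `K p` lies between the straightened images of the two walls of column `j`, which are 1/N
    -- apart; this strip contains only one column of punctures.
    have hlt : (a : ℝ) < j + 1 + k + N * c := by
      obtain ⟨V, hVc, hVp, hV0, hVG, d, hd⟩ := hV (j + 1) hj
      have := fst_lt_of_homotopy hKc hK.injective hv hh (p := p) (a := ((j + 1 : ℕ) : ℝ) / N)
        (by rw [hp]; push_cast; gcongr; norm_num) hVc hV0 (hVper hVc hVp ⟨d, hd⟩)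
        (hfst hj hVG d hd) (havoid hj hVp)
      rw [hab, div_lt_iff₀ (by positivity), add_mul, div_mul_cancel₀ _ hN'] at this
      push_cast at this
      nlinarith
    have hgt : (j : ℝ) + k + N * c < a + 1 := by
      obtain ⟨V, hVc, hVp, hV0, hVG, d, hd⟩ := hV j hj.le
      have := lt_fst_of_homotopy hKc hK.injective hv hh (p := p) (a := (j : ℝ) / N)
        (by rw [hp]; push_cast; gcongr; norm_num) hVc hV0 (hVper hVc hVp ⟨d, hd⟩)
        (hfst hj.le hVG d hd) (havoid hj.le hVp)
      rw [hab, lt_div_iff₀ (by positivity), add_mul, div_mul_cancel₀ _ hN'] at this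
      nlinarith
    have ha : a = j + k + N * c := by
      have h1 : a < j + 1 + k + N * c := by exact_mod_cast hlt
      have h2 : (j : ℤ) + k + N * c < a + 1 := by exact_mod_cast hgt
      omega
    refine ⟨b, ?_⟩
    rw [hab, ha]
    push_cast
    simp only [add_assoc]
  refine ⟨hv, hh, k + N * c, fun a b => ?_⟩
  obtain ⟨j, hjN, ha⟩ := exists_eq_add_mul hN a
  obtain ⟨b', hb'⟩ := hsqueeze j hjN
  refine ⟨b' + (a / N + b), ?_⟩
  have e : (((a : ℝ) + 1 / 2) / N, (b : ℝ) + 1 / 2) =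
      (((j : ℤ) + 1 / 2 : ℝ) / N, ((0 : ℤ) : ℝ) + 1 / 2) + latticeVec (a / N, b) := by
    rw [ha]
    ext <;> simp [latticeVec]
    · field_simp; ring
    · ring
  rw [e, add_latticeVec_of_shear hv hh, hb', ha]
  ext <;> simp [latticeVec]
  · field_simp; ring
  · ring

/-- Iterates of `f` are injective, so a return of any orbit point is also a return of the base
point, and `n` iterates exhaust the orbit. -/
theorem IsPeriodicOrbit.ncard_le {f : Torus ≃ₜ Torus} {x : Set Torus} (h : IsPeriodicOrbit f x)
    {w : Torus} (hw : w ∈ x) {n : ℕ} (hn : 0 < n) (hfw : f^[n] w = w) : x.ncard ≤ n := by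
  obtain ⟨p, ⟨r, hr, hp⟩, rfl⟩ := h
  obtain ⟨m, rfl⟩ := hw
  simp only at hfw
  have hfp : Function.IsPeriodicPt f n p := by
    have hinj : Function.Injective f^[m] := f.injective.iterate m
    apply hinj
    rw [← Function.iterate_add_apply, add_comm, Function.iterate_add_apply, hfw]
  have hsub : Set.range (fun n : ℕ => f^[n] p) ⊆ (fun n : ℕ => f^[n] p) '' (Finset.range n) := by
    rintro _ ⟨m, rfl⟩
    exact ⟨m % n, by simpa using Nat.mod_lt _ hn, hfp.iterate_mod_apply m⟩
  calc _ ≤ _ := Set.ncard_le_ncard hsub ((Finset.finite_toSet _).image _)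
    _ ≤ _ := Set.ncard_image_le (Finset.finite_toSet _)
    _ = n := by simp

theorem IsPeriodicOrbit.mapsTo {f : Torus ≃ₜ Torus} {x : Set Torus} (h : IsPeriodicOrbit f x) :
    Set.MapsTo f x x := by
  obtain ⟨p, -, rfl⟩ := h
  rintro _ ⟨m, rfl⟩
  exact ⟨m + 1, Function.iterate_succ_apply' f m p⟩

theorem IsLift.iterate {f : Torus ≃ₜ Torus} {F : ℝ × ℝ → ℝ × ℝ} (hF : IsLift F f) (n : ℕ)
    (v : ℝ × ℝ) : proj (F^[n] v) = f^[n] (proj v) :=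
  (Function.Semiconj.iterate_right (f := proj) hF.2 n) v

/-- The rotation number of a simple orbit of length `N` is `q / N` with `q` coprime to `N`. -/
theorem IsSimpleOrbit.not_dvd {f : Torus ≃ₜ Torus} {x : Set Torus} (h : IsSimpleOrbit f x)
    {F : ℝ × ℝ → ℝ × ℝ} (hF : IsLift F f)
    (hFa : ∀ v, F (v + latticeVec (1, 0)) = F v + latticeVec (1, 1))
    (hFb : ∀ v, F (v + latticeVec (0, 1)) = F v + latticeVec (0, 1))
    {z : ℝ × ℝ} (hz : proj z ∈ x) {q s : ℤ} (hq : F^[x.ncard] z = z + latticeVec (q, s))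
    {n : ℕ} (hn : 0 < n) (hnN : n < x.ncard) : ¬ (x.ncard : ℤ) ∣ n * q := by
  obtain ⟨hper, Φ, hΦ, f', hf', U, -, -, hUx, -, k, -, i, hi, H, hH, hHU, hH0, hvert, hhor,
    htw, htw'⟩ := h
  set N := x.ncard with hN
  have hN0 : 0 < N := by omega
  have hNR : (N : ℝ) ≠ 0 := by positivity
  have hf'x : ∀ a ∈ x, f' a = f a := by
    obtain ⟨J, -, -, hJ1, hJ⟩ := hf'
    intro a ha
    rw [← hJ1, hJ 1 a ha]
  obtain ⟨F', hF', hF'x, hF'l⟩ := hf'.exists_isLift hF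
  obtain ⟨P, Q, hP, hQ, hQP, hPQ⟩ := exists_isLift_inverse Φ
  have hPc := hP.1
  have hQc := hQ.1
  have hF'c := hF'.1
  have hmem : ∀ p, Φ.symm p ∈ stdPunctures N ↔ p ∈ x := fun p => by
    rw [← hΦ]
    exact ⟨fun hp => ⟨_, hp, by simp⟩, by rintro ⟨w, hw, rfl⟩; simpa using hw⟩
  have hK : IsLift (fun v => Q (F' (P v))) ((Φ.trans f').trans Φ.symm) :=
    ⟨by fun_prop, fun v => by simp [hQ.2, hF'.2, hP.2]⟩
  set K : ℝ × ℝ → ℝ × ℝ := fun v => Q (F' (P v)) with hKdef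
  obtain ⟨hv, hh, κ, hκ⟩ := exists_shift_of_homotopy hN0 hi hK
    (H := fun t p => Φ.symm (H t p)) (k := k)
    (fun p hp => by
      have hp' : Φ p ∈ x := by rw [← hΦ]; exact ⟨p, hp, rfl⟩
      show Φ.symm (f' (Φ p)) ∈ _
      rw [hmem, hf'x _ hp']
      exact hper.mapsTo hp')
    (Φ.symm.continuous.comp_continuousOn hH)
    (fun t p hp hp' => Set.disjoint_left.1 hUx (hHU t p hp) ((hmem _).1 hp'))
    (fun p hp => by simp [hH0 p hp])
    (fun j hj s => by simp [hvert j hj s])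
    (fun j hj hji t ht => by simp [hhor j hj hji t ht])
    (fun t ht => by simp [htw t ht])
    (fun t ht => by simp [htw' t ht])
  have hPK : ∀ v, P (K v) = F' (P v) := fun v => hPQ _
  have hPKn : ∀ m v, P (K^[m] v) = F'^[m] (P v) := fun m v =>
    (Function.Semiconj.iterate_right (f := P) hPK m) v
  have hF'n : ∀ m, F'^[m] z = F^[m] z ∧ proj (F^[m] z) ∈ x := by
    intro m
    induction m with
    | zero => exact ⟨rfl, hz⟩
    | succ m ih =>
      rw [Function.iterate_succ_apply', Function.iterate_succ_apply', ih.1]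
      exact ⟨hF'x _ ih.2, by rw [hF.2]; exact hper.mapsTo ih.2⟩
  -- iterates of the lift on the punctures
  obtain ⟨a, b, hab⟩ := (proj_mem_stdPunctures_iff hN0).1
    (show proj (Q z) ∈ stdPunctures N by rwa [hQ.2, hmem])
  have hKn : ∀ m : ℕ, ∃ b' : ℤ,
      K^[m] (Q z) = (((a + m * κ : ℤ) + 1 / 2 : ℝ) / N, (b' : ℝ) + 1 / 2) := by
    intro m
    induction m with
    | zero => exact ⟨b, by simp [hab]⟩
    | succ m ih =>
      obtain ⟨b', hb'⟩ := ih
      obtain ⟨b'', hb''⟩ := hκ (a + m * κ) b'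
      refine ⟨b'', ?_⟩
      rw [Function.iterate_succ_apply', hb', hb'']
      ext
      · push_cast; ring
      · rfl
  have hKn' : ∀ (m : ℕ) (r : ℤ), m * κ = N * r → ∃ l : ℤ, K^[m] (Q z) = Q z + latticeVec (r, l) := by
    intro m r hr
    obtain ⟨b', hb'⟩ := hKn m
    have hr' : (m : ℝ) * κ = N * r := by exact_mod_cast hr
    refine ⟨b' - b, ?_⟩
    rw [hb', hab]
    ext
    · simp [latticeVec, hr']; field_simp; ring
    · simp [latticeVec]; ring
  -- the action of `Φ` on the lattice
  obtain ⟨⟨α, β⟩, hα⟩ := hP.exists_add_latticeVec (1, 0)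
  obtain ⟨⟨γ, δ⟩, hγ⟩ := hP.exists_add_latticeVec (0, 1)
  have hlat : ∀ (m l : ℤ) v,
      P (v + latticeVec (m, l)) = P v + latticeVec (m * α + l * γ, m * β + l * δ) := by
    intro m l v
    have e : latticeVec (m, l) = m • latticeVec (1, 0) + l • latticeVec (0, 1) := by
      ext <;> simp [latticeVec]
    rw [e, ← add_assoc, map_add_zsmul_of_map_add hγ, map_add_zsmul_of_map_add hα]
    ext <;> simp [latticeVec] <;> ring
  have hF'lat : ∀ (m l : ℤ) v, F' (v + latticeVec (m, l)) = F' v + latticeVec (m, m + l) :=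
    fun m l v => add_latticeVec_of_shear
      (fun v => by simpa [latticeVec] using hF'l _ _ hFb v)
      (fun v => by simpa [latticeVec] using hF'l _ _ hFa v) m l v
  -- `P` conjugates `K` to `F'`, which act on the lattice by the same shear. The vertical class is
  -- fixed, so its image is fixed, and only vertical classes are.
  have hγ0 : γ = 0 := by
    have h1 := hPK (0 + latticeVec (0, 1))
    have e : latticeVec (0, 1) = (0, 1) := by simp [latticeVec]
    rw [hγ, hF'lat, e, hv, ← e, hγ, hPK, add_left_cancel_iff] at h1
    have := congrArg Prod.snd (latticeVec_injective h1)
    simp only at this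
    omega
  subst hγ0
  obtain ⟨⟨α', β'⟩, hα'⟩ := hQ.exists_add_latticeVec (1, 0)
  have hunit : α' * α = 1 := by
    have h1 := congrArg P (hα' 0)
    rw [hPQ, hlat, hPQ, add_left_cancel_iff] at h1
    simpa using (congrArg Prod.fst (latticeVec_injective h1)).symm
  -- Compare N-th iterates: `K` advances by κ horizontal units, and `P` multiplies horizontal units
  -- by α = ±1.
  have hqκ : q = κ * α := by
    obtain ⟨l, hl⟩ := hKn' N κ rfl
    have h1 := hPKn N (Q z)
    rw [hl, hlat, hPQ, (hF'n N).1, hq, add_left_cancel_iff] at h1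
    simpa using (congrArg Prod.fst (latticeVec_injective h1)).symm
  rintro ⟨r, hr⟩
  -- As α is a unit, N divides nκ. Then the n-th iterate of `K` moves `Q z` by a lattice vector, so
  -- the orbit closes up after n < N steps.
  obtain ⟨l, hl⟩ := hKn' n (α' * r) (by
    rw [hqκ] at hr
    linear_combination α' * hr - n * κ * hunit)
  have h1 := hPKn n (Q z)
  rw [hl, hlat, hPQ, (hF'n n).1] at h1
  have h2 := hper.ncard_le hz hn (by rw [← hF.iterate, ← h1, proj_add_latticeVec])
  omega

/-! ### Similarity and forcing -/

/-- If all periodic orbits of `f` are images of `x` under symmetries of `f` isotopic to the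
identity, then `x` forces only orbits of its own type. -/
theorem similar_of_forces {f : Torus ≃ₜ Torus} {x : Set Torus} (hx : IsPeriodicOrbit f x)
    (hall : ∀ y, IsPeriodicOrbit f y → ∃ τ : Torus ≃ₜ Torus,
      Isotopic τ (Homeomorph.refl Torus) ∧ τ '' x = y ∧ ∀ p, τ (f p) = f (τ p))
    {g : Torus ≃ₜ Torus} {y : Set Torus} (h : Forces f x g y) : Similar f x g y := by
  -- Forcing is tested on `f` itself, with `x` similar to itself by the identity.
  obtain ⟨y', hy', ψ, ⟨H, hH, hH0, hH1, -⟩, hψ, K, hK, hK0, hK1, hKx⟩ := h f x hx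
    ⟨Homeomorph.refl Torus, ⟨fun _ => Homeomorph.refl Torus, continuous_snd, rfl, rfl, by simp⟩,
      by simp, fun _ => f, f.continuous.comp continuous_snd, by ext <;> rfl, rfl,
      fun _ _ _ => rfl⟩
  obtain ⟨τ, ⟨S, hS, hS0, hS1, -⟩, hτ, hcomm⟩ := hall y' hy'
  have hτ' : ∀ p, τ (f (τ.symm p)) = f p := fun p => by simp [hcomm]
  have hψ' : ∀ a ∈ y, ψ a ∈ y' := fun a ha => hψ ▸ ⟨a, ha, rfl⟩
  -- The similarity goes from `x` to `y'` by τ and on to `y` by the inverse of ψ. Since τ commutes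
  -- with `f`, the required isotopy is `K` run backwards and conjugated by ψ.
  refine ⟨τ.trans ψ.symm, ⟨fun t => ((S t).trans (H (unitInterval.symm t))).trans ψ.symm,
    ?_, ?_, ?_, by simp⟩, ?_, fun t => (ψ.trans (K (unitInterval.symm t))).trans ψ.symm,
    ?_, ?_, ?_, ?_⟩
  · exact ψ.symm.continuous.comp
      (hH.comp ((unitInterval.continuous_symm.comp continuous_fst).prodMk hS))
  · ext1 p
    simp [hS0, hH1]
  · ext1 p
    simp [hS1, hH0]
  · rw [← hψ] at hτ
    rw [show ⇑(τ.trans ψ.symm) = ψ.symm ∘ τ from rfl, Set.image_comp, hτ, ← Set.image_comp]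
    simp
  · exact ψ.symm.continuous.comp (hK.comp
      ((unitInterval.continuous_symm.comp continuous_fst).prodMk
        (ψ.continuous.comp continuous_snd)))
  · ext1 p
    simp [hK1, hτ']
  · ext1 p
    simp [hK0]
  · intro t a ha
    have h0 := hKx (unitInterval.symm t) _ (hψ' a ha)
    have h1 := hKx 1 _ (hψ' a ha)
    rw [hK1] at h1
    simp [h0, hτ', ← h1]

/-! ### A shear map all of whose periodic orbits have the same type -/

theorem _root_.Function.Periodic.continuous_lift {X : Type*} [TopologicalSpace X] {g : ℝ → X}
    (hp : Function.Periodic g 1) (hg : Continuous g) :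
    Continuous (hp.lift : UnitAddCircle → X) :=
  (QuotientAddGroup.isQuotientMap_mk (N := AddSubgroup.zmultiples (1 : ℝ))).continuous_iff.2 hg

theorem periodic_trig {g : ℝ → ℝ} (hg : Function.Periodic g (2 * Real.pi)) (n : ℕ) (a b : ℝ) :
    Function.Periodic (fun x : ℝ => a + g (2 * n * Real.pi * x) * b) 1 := fun x => by
  have : 2 * n * Real.pi * (x + 1) = 2 * n * Real.pi * x + n * (2 * Real.pi) := by ring
  simp only [this, hg.nat_mul n _]

/-- The function on the circle given by `a + g (2 n π x) b` for a trigonometric function `g`. -/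
noncomputable def trig {g : ℝ → ℝ} (hg : Function.Periodic g (2 * Real.pi)) (n : ℕ) (a b : ℝ) :
    UnitAddCircle → ℝ :=
  (periodic_trig hg n a b).lift

theorem trig_coe {g : ℝ → ℝ} (hg : Function.Periodic g (2 * Real.pi)) (n : ℕ) (a b x : ℝ) :
    trig hg n a b x = a + g (2 * n * Real.pi * x) * b := rfl

theorem continuous_trig {g : ℝ → ℝ} (hg : Function.Periodic g (2 * Real.pi)) (hc : Continuous g)
    (n : ℕ) (a b : ℝ) : Continuous (trig hg n a b) :=
  (periodic_trig hg n a b).continuous_lift (by fun_prop)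

/-- The lift of `circleMap t`. -/
noncomputable def circleLift (t x : ℝ) : ℝ :=
  x + t * (11 / 20 + Real.cos (4 * Real.pi * x) * (1 / 20))

/-- A homotopy of circle maps from the identity at `t = 0` to a map at `t = 1` whose only periodic
points are `1 / 4` and `3 / 4`, which it interchanges. -/
noncomputable def circleMap (t : ℝ) (a : UnitAddCircle) : UnitAddCircle :=
  a + ((t * trig Real.cos_periodic 2 (11 / 20) (1 / 20) a : ℝ) : UnitAddCircle)

theorem circleMap_coe (t x : ℝ) : circleMap t x = circleLift t x := by
  rw [circleMap, trig_coe, ← AddCircle.coe_add, circleLift]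
  norm_num

theorem continuous_circleMap : Continuous fun q : ℝ × UnitAddCircle => circleMap q.1 q.2 := by
  have h1 := continuous_trig Real.cos_periodic Real.continuous_cos 2 (11 / 20) (1 / 20)
  have h2 := AddCircle.continuous_mk' (1 : ℝ)
  exact continuous_snd.add (h2.comp (by fun_prop))

theorem continuous_circleLift (t : ℝ) : Continuous (circleLift t) := by
  unfold circleLift; fun_prop

theorem circleLift_add_int (t x : ℝ) (n : ℤ) : circleLift t (x + n) = circleLift t x + n := by
  have : 4 * Real.pi * (x + n) = 4 * Real.pi * x + (2 * n : ℤ) * (2 * Real.pi) := by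
    push_cast; ring
  rw [circleLift, circleLift, this, Real.cos_add_int_mul_two_pi]
  ring

/-- The amplitude 1/20 is small enough: the cosine term has slope at most 4π/20 < 1 in absolute
value. -/
theorem strictMono_circleLift {t : ℝ} (h0 : 0 ≤ t) (h1 : t ≤ 1) : StrictMono (circleLift t) := by
  intro x y hxy
  have h := Real.abs_cos_sub_cos_le (4 * Real.pi * x) (4 * Real.pi * y)
  have e : 4 * Real.pi * x - 4 * Real.pi * y = -(4 * Real.pi * (y - x)) := by ring
  have hpos : 0 ≤ 4 * Real.pi * (y - x) := by
    have := Real.pi_pos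
    have := sub_pos.2 hxy
    positivity
  rw [e, abs_neg, abs_of_nonneg hpos] at h
  have h2 := (abs_le.1 h).2
  have h3 : 4 * Real.pi * (y - x) < 20 * (y - x) :=
    mul_lt_mul_of_pos_right (by linarith [Real.pi_lt_four]) (sub_pos.2 hxy)
  have h4 : t * (Real.cos (4 * Real.pi * x) - Real.cos (4 * Real.pi * y)) < 20 * (y - x) := by
    nlinarith
  unfold circleLift
  linarith

theorem surjective_circleLift {t : ℝ} (h0 : 0 ≤ t) (h1 : t ≤ 1) :
    Function.Surjective (circleLift t) := by
  have hb : ∀ x, x - 1 ≤ circleLift t x ∧ circleLift t x ≤ x + 1 := fun x => by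
    have := Real.neg_one_le_cos (4 * Real.pi * x)
    have := Real.cos_le_one (4 * Real.pi * x)
    unfold circleLift
    constructor <;> nlinarith
  refine (continuous_circleLift t).surjective ?_ ?_
  · exact Filter.tendsto_atTop_mono (fun x => (hb x).1)
      (Filter.tendsto_atTop_add_const_right _ (-1) Filter.tendsto_id)
  · exact Filter.tendsto_atBot_mono (fun x => (hb x).2)
      (Filter.tendsto_atBot_add_const_right _ 1 Filter.tendsto_id)

theorem bijective_circleMap {t : ℝ} (h0 : 0 ≤ t) (h1 : t ≤ 1) :
    Function.Bijective (circleMap t) := by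
  constructor
  · intro a b hab
    obtain ⟨x, rfl⟩ := QuotientAddGroup.mk_surjective a
    obtain ⟨y, rfl⟩ := QuotientAddGroup.mk_surjective b
    have h := (circleMap_coe t x).symm.trans (hab.trans (circleMap_coe t y))
    obtain ⟨n, hn⟩ := coe_eq_coe_iff.1 h
    rw [← circleLift_add_int] at hn
    exact coe_eq_coe_iff.2 ⟨n, (strictMono_circleLift h0 h1).injective hn⟩
  · intro b
    obtain ⟨y, rfl⟩ := QuotientAddGroup.mk_surjective b
    obtain ⟨x, rfl⟩ := surjective_circleLift h0 h1 y
    exact ⟨x, circleMap_coe t x⟩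

/-- `circleMap t` as a homeomorphism. -/
noncomputable def circleHomeo (t : unitInterval) : UnitAddCircle ≃ₜ UnitAddCircle :=
  Continuous.homeoOfEquivCompactToT2 (f := Equiv.ofBijective _ (bijective_circleMap t.2.1 t.2.2))
    (continuous_circleMap.comp (by fun_prop : Continuous fun a => ((t : ℝ), a)))

theorem circleLift_one_quarter (m : ℤ) : circleLift 1 (1 / 4 + m / 2) = 1 / 4 + (m + 1) / 2 := by
  have : 4 * Real.pi * (1 / 4 + m / 2) = Real.pi + m * (2 * Real.pi) := by ring
  rw [circleLift, this, Real.cos_add_int_mul_two_pi, Real.cos_pi]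
  ring

/-- The displacement has minimum 11/20 - 1/20 = 1/2, attained only where cos(4πx) = -1. -/
theorem lt_circleLift_one {x : ℝ} (hx : ∀ m : ℤ, x ≠ 1 / 4 + m / 2) :
    x + 1 / 2 < circleLift 1 x := by
  have h : Real.cos (4 * Real.pi * x) ≠ -1 := fun h => by
    obtain ⟨k, hk⟩ := Real.cos_eq_neg_one_iff.1 h
    refine hx k (mul_left_cancel₀ (mul_ne_zero four_ne_zero Real.pi_ne_zero) ?_)
    linear_combination -hk
  have := lt_of_le_of_ne (Real.neg_one_le_cos _) h.symm
  unfold circleLift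
  linarith

theorem ne_quarter {x : ℝ} {m : ℤ} (h1 : 1 / 4 + (m : ℝ) / 2 < x)
    (h2 : x < 1 / 4 + ((m : ℝ) + 1) / 2) (l : ℤ) : x ≠ 1 / 4 + l / 2 := by
  rintro rfl
  have h3 : m < l := by exact_mod_cast (by linarith : (m : ℝ) < l)
  have h4 : l < m + 1 := by exact_mod_cast (by linarith : (l : ℝ) < m + 1)
  omega

/-- The only periodic points of `circleMap 1` are `1 / 4` and `3 / 4`. -/
theorem eq_quarter_of_isPeriodicPt {x : ℝ} {n : ℕ} (hn : 0 < n)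
    (h : (circleMap 1)^[n] x = x) : ∃ m : ℤ, x = 1 / 4 + m / 2 := by
  by_contra! hx
  obtain ⟨m, hm1, hm2⟩ : ∃ m : ℤ, 1 / 4 + (m : ℝ) / 2 < x ∧ x < 1 / 4 + ((m : ℝ) + 1) / 2 := by
    refine ⟨⌊2 * x - 1 / 2⌋, lt_of_le_of_ne ?_ (hx _).symm, ?_⟩
    · linarith [Int.floor_le (2 * x - 1 / 2)]
    · linarith [Int.lt_floor_add_one (2 * x - 1 / 2)]
  have hit : ∀ n : ℕ, (circleMap 1)^[n] x = ((circleLift 1)^[n] x : ℝ) := fun n => by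
    have : Function.Semiconj (fun x : ℝ => (x : UnitAddCircle)) (circleLift 1) (circleMap 1) :=
      fun x => (circleMap_coe 1 x).symm
    exact (this.iterate_right n x).symm
  have hmono := strictMono_circleLift zero_le_one le_rfl
  -- The gap around `x` moves by exactly 1/2 per step, while the point inside it moves by more and,
  -- by monotonicity, never leaves it. A return with displacement `l` would give n < 2l < n + 1.
  have hbd : ∀ n : ℕ, x + n / 2 ≤ (circleLift 1)^[n] x ∧ (0 < n → x + n / 2 < (circleLift 1)^[n] x) ∧
      (circleLift 1)^[n] x < 1 / 4 + ((m : ℝ) + n + 1) / 2 := by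
    intro n
    induction n with
    | zero => simpa using hm2
    | succ n ih =>
      obtain ⟨i1, -, i3⟩ := ih
      rw [Function.iterate_succ_apply']
      set y := (circleLift 1)^[n] x
      have h1 : y + 1 / 2 < circleLift 1 y := lt_circleLift_one fun l =>
        ne_quarter (m := m + n) (by push_cast; linarith) (by push_cast; linarith) l
      have h2 := hmono i3
      have h3 := circleLift_one_quarter (m + n + 1)
      push_cast at h3
      rw [h3] at h2
      push_cast
      refine ⟨?_, fun _ => ?_, ?_⟩ <;> linarith
  rw [hit] at h
  obtain ⟨l, hl⟩ := coe_eq_coe_iff.1 h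
  obtain ⟨-, h1, h2⟩ := hbd n
  have h1 := h1 hn
  rw [hl] at h1 h2
  have h3 : (n : ℤ) < 2 * l := by exact_mod_cast (by linarith : (n : ℝ) < 2 * l)
  have h4 : 2 * l < n + 1 := by exact_mod_cast (by linarith : (2 * l : ℝ) < n + 1)
  omega

end Torus

end

/-! ### Skew products on the torus and the change of coordinates -/

namespace Torus

/-- The vertical shear `(x, y) ↦ (x, y + w x)`. -/
def vshear (w : UnitAddCircle → UnitAddCircle) (hw : Continuous w) : Torus ≃ₜ Torus where
  toFun p := (p.1, p.2 + w p.1)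
  invFun p := (p.1, p.2 - w p.1)
  left_inv p := by simp
  right_inv p := by simp
  continuous_toFun := by fun_prop
  continuous_invFun := by fun_prop

/-- The horizontal shear `(x, y) ↦ (x + u y, y)`. -/
def hshear (u : UnitAddCircle → UnitAddCircle) (hu : Continuous u) : Torus ≃ₜ Torus where
  toFun p := (p.1 + u p.2, p.2)
  invFun p := (p.1 - u p.2, p.2)
  left_inv p := by simp
  right_inv p := by simp
  continuous_toFun := by fun_prop
  continuous_invFun := by fun_prop

/-- A family of shear maps, from the linear Dehn twist at `t = 0` to a map at `t = 1` all of whose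
periodic points lie on the circles `x = 1 / 4` and `x = 3 / 4` and have period `4`. -/
noncomputable def shearMap (t : unitInterval) : Torus ≃ₜ Torus :=
  (vshear (fun x => x - ((t / 4 : ℝ) : UnitAddCircle)) (by fun_prop)).trans
    ((circleHomeo t).prodCongr (Homeomorph.refl _))

theorem shearMap_apply (t : unitInterval) (p : Torus) :
    shearMap t p = (circleMap t p.1, p.2 + (p.1 - ((t / 4 : ℝ) : UnitAddCircle))) := rfl

theorem continuous_shearMap : Continuous fun q : unitInterval × Torus => shearMap q.1 q.2 := by
  simp only [shearMap_apply]
  have h1 := AddCircle.continuous_mk' (1 : ℝ)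
  refine (continuous_circleMap.comp (by fun_prop :
    Continuous fun q : unitInterval × Torus => ((q.1 : ℝ), q.2.1))).prodMk ?_
  have h2 : Continuous fun q : unitInterval × Torus => (((q.1 : ℝ) / 4 : ℝ) : UnitAddCircle) :=
    h1.comp (by fun_prop)
  fun_prop

theorem shearMap_zero : shearMap 0 = dehnTwist := by
  ext1 p
  simp [shearMap_apply, dehnTwist, circleMap]

/-- The lift of `shearMap 1` to the plane. -/
noncomputable def shearLift (v : ℝ × ℝ) : ℝ × ℝ := (circleLift 1 v.1, v.2 + v.1 - 1 / 4)

theorem isLift_shearLift : IsLift shearLift (shearMap 1) := by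
  have h := continuous_circleLift 1
  refine ⟨by unfold shearLift; fun_prop, fun v => Prod.ext ?_ ?_⟩
  · exact (circleMap_coe 1 v.1).symm
  · simp [proj, shearLift, shearMap_apply, add_sub_assoc]

theorem proj_shearLift (v : ℝ × ℝ) : proj (shearLift v) = shearMap 1 (proj v) :=
  isLift_shearLift.2 v

theorem shearLift_add_latticeVec (v : ℝ × ℝ) (m n : ℤ) :
    shearLift (v + latticeVec (m, n)) = shearLift v + latticeVec (m, m + n) := by
  ext
  · simp [shearLift, latticeVec, circleLift_add_int]
  · simp [shearLift, latticeVec]; ring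

/-- The constant -1/4 makes the fibre displacement an integer for even `m` and a half-integer for
odd `m`, so two steps give a half-turn. -/
theorem shearLift_quarter (m : ℤ) (y : ℝ) :
    shearLift (1 / 4 + (m : ℝ) / 2, y) = (1 / 4 + ((m + 1 : ℤ) : ℝ) / 2, y + m / 2) := by
  ext
  · simpa [shearLift] using circleLift_one_quarter m
  · simp [shearLift]; ring

/-- The change of coordinates that takes the circles `x = 1 / 4` and `x = 3 / 4` to curves through
four points on the line `y = 1 / 2`. -/
noncomputable def coordChange : Torus ≃ₜ Torus :=
  (hshear (fun y => ((trig Real.cos_periodic 1 0 (1 / 8) y : ℝ) : UnitAddCircle))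
    ((AddCircle.continuous_mk' (1 : ℝ)).comp
      (continuous_trig Real.cos_periodic Real.continuous_cos _ _ _))).trans
  (vshear (fun x => ((trig Real.sin_periodic 2 (1 / 4) (-1 / 4) x : ℝ) : UnitAddCircle))
    ((AddCircle.continuous_mk' (1 : ℝ)).comp
      (continuous_trig Real.sin_periodic Real.continuous_sin _ _ _)))

/-- The lift of `coordChange` to the plane. -/
noncomputable def coordLift (v : ℝ × ℝ) : ℝ × ℝ :=
  (v.1 + Real.cos (2 * Real.pi * v.2) / 8,
    v.2 + (1 - Real.sin (4 * Real.pi * (v.1 + Real.cos (2 * Real.pi * v.2) / 8))) / 4)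

theorem isLift_coordLift : IsLift coordLift coordChange := by
  refine ⟨by unfold coordLift; fun_prop, fun v => ?_⟩
  simp only [coordChange, Homeomorph.trans_apply, hshear, vshear, Homeomorph.homeomorph_mk_coe,
    Equiv.coe_fn_mk, proj, trig_coe, ← AddCircle.coe_add, coordLift]
  congr 3 <;> push_cast <;> ring_nf

theorem proj_coordLift (v : ℝ × ℝ) : proj (coordLift v) = coordChange (proj v) :=
  isLift_coordLift.2 v

theorem coordLift_add_latticeVec (v : ℝ × ℝ) (m n : ℤ) :
    coordLift (v + latticeVec (m, n)) = coordLift v + latticeVec (m, n) := by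
  have h1 : Real.cos (2 * Real.pi * (v.2 + n)) = Real.cos (2 * Real.pi * v.2) := by
    rw [show 2 * Real.pi * (v.2 + n) = 2 * Real.pi * v.2 + n * (2 * Real.pi) by ring,
      Real.cos_add_int_mul_two_pi]
  have h2 : ∀ x : ℝ, Real.sin (4 * Real.pi * (v.1 + m + x)) = Real.sin (4 * Real.pi * (v.1 + x)) := by
    intro x
    rw [show 4 * Real.pi * (v.1 + m + x) = 4 * Real.pi * (v.1 + x) + (2 * m : ℤ) * (2 * Real.pi) by
      push_cast; ring, Real.sin_add_int_mul_two_pi]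
  ext
  · simp [coordLift, latticeVec, h1]; ring
  · simp [coordLift, latticeVec, h1, h2]; ring

/-- The horizontal shear separates heights 1/2 and 0 by -1/8 and +1/8; the vertical shear is then 0
on the first points and 1/2 on the second, which brings all four to one level. -/
theorem coordLift_quarter (m n : ℤ) :
    coordLift (1 / 4 + (m : ℝ) / 2, (n : ℝ) + 1 / 2) = (1 / 8 + (m : ℝ) / 2, (n : ℝ) + 1 / 2) ∧
    coordLift (1 / 4 + (m : ℝ) / 2, n) = (3 / 8 + (m : ℝ) / 2, (n : ℝ) + 1 / 2) := by
  have h1 : Real.cos (2 * Real.pi * (n + 1 / 2)) = -1 := by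
    rw [show 2 * Real.pi * ((n : ℝ) + 1 / 2) = Real.pi + n * (2 * Real.pi) by ring,
      Real.cos_add_int_mul_two_pi, Real.cos_pi]
  have h2 : Real.cos (2 * Real.pi * n) = 1 := by
    rw [show 2 * Real.pi * (n : ℝ) = 0 + n * (2 * Real.pi) by ring,
      Real.cos_add_int_mul_two_pi, Real.cos_zero]
  have h3 : Real.sin (4 * Real.pi * (1 / 4 + m / 2 + -1 / 8)) = 1 := by
    rw [show 4 * Real.pi * (1 / 4 + (m : ℝ) / 2 + -1 / 8) = Real.pi / 2 + m * (2 * Real.pi) by ring,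
      Real.sin_add_int_mul_two_pi, Real.sin_pi_div_two]
  have h4 : Real.sin (4 * Real.pi * (1 / 4 + m / 2 + 1 / 8)) = -1 := by
    rw [show 4 * Real.pi * (1 / 4 + (m : ℝ) / 2 + 1 / 8) =
      Real.pi / 2 + Real.pi + m * (2 * Real.pi) by ring,
      Real.sin_add_int_mul_two_pi, Real.sin_add_pi, Real.sin_pi_div_two]
  simp only [coordLift, h1, h2, h3, h4]
  constructor <;> ext <;> simp <;> ring

/-! ### Dynamics and symmetries of the example -/

theorem exists_eq_quarter_of_isPeriodicPt {p : Torus} {n : ℕ} (hn : 0 < n)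
    (h : (shearMap 1)^[n] p = p) : ∃ (m : ℤ) (y : ℝ), p = proj (1 / 4 + (m : ℝ) / 2, y) := by
  obtain ⟨v, rfl⟩ := proj_surjective p
  have hs : Function.Semiconj Prod.fst (shearMap 1) (circleMap 1) := fun _ => rfl
  have h1 := hs.iterate_right n (proj v)
  rw [h] at h1
  obtain ⟨m, hm⟩ := eq_quarter_of_isPeriodicPt hn h1.symm
  exact ⟨m, v.2, by rw [← hm]⟩

/-- The map `shearMap 1` in the new coordinates. -/
noncomputable def twistMap : Torus ≃ₜ Torus := (coordChange.symm.trans (shearMap 1)).trans coordChange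

theorem twistMap_coordChange (p : Torus) :
    twistMap (coordChange p) = coordChange (shearMap 1 p) := by
  simp [twistMap]

theorem coordChange_symm_iterate (n : ℕ) (p : Torus) :
    coordChange.symm (twistMap^[n] p) = (shearMap 1)^[n] (coordChange.symm p) :=
  (Function.Semiconj.iterate_right (f := coordChange.symm) (ga := twistMap) (gb := shearMap 1)
    (fun p => by simp [twistMap]) n) p

theorem twistMap_proj_coordLift (v : ℝ × ℝ) :
    twistMap (proj (coordLift v)) = proj (coordLift (shearLift v)) := by
  rw [proj_coordLift, twistMap_coordChange, ← proj_shearLift, proj_coordLift]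

theorem isShear_twistMap : IsShear twistMap := by
  refine ⟨coordChange, fun t =>
    (coordChange.symm.trans (shearMap (unitInterval.symm t))).trans coordChange, ?_, ?_, ?_, ?_⟩
  · have h1 : Continuous fun q : unitInterval × Torus =>
        (unitInterval.symm q.1, coordChange.symm q.2) :=
      (unitInterval.continuous_symm.comp continuous_fst).prodMk
        (coordChange.symm.continuous.comp continuous_snd)
    have h2 := continuous_shearMap.comp h1
    exact coordChange.continuous.comp h2
  · simp [twistMap]
  · simp [shearMap_zero]
  · simp

/-- The lift is `shearLift` conjugated by `coordLift`, which commutes with lattice translations; the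
inverse of `coordLift` is `Q` corrected by the lattice vector between `P` and `coordLift`. -/
theorem exists_isLift_twistMap : ∃ F, IsLift F twistMap ∧
    (∀ v, F (coordLift v) = coordLift (shearLift v)) ∧
    ∀ (m n : ℤ) v, F (v + latticeVec (m, n)) = F v + latticeVec (m, m + n) := by
  obtain ⟨P, Q, hP, hQ, hQP, hPQ⟩ := exists_isLift_inverse coordChange
  obtain ⟨n, hn⟩ := exists_eq_add_latticeVec hP.1 isLift_coordLift.1
    fun v => by rw [hP.2, proj_coordLift]
  have hinv : ∀ v, coordLift (Q (v + latticeVec n)) = v := fun v => by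
    have := hn (Q (v + latticeVec n))
    rwa [hPQ, add_right_cancel_iff, eq_comm] at this
  have hinv' : ∀ v, Q (coordLift v + latticeVec n) = v := fun v => by rw [← hn, hQP]
  have h1 := isLift_coordLift.1
  have h2 := isLift_shearLift.1
  have h3 := hQ.1
  refine ⟨fun v => coordLift (shearLift (Q (v + latticeVec n))), ⟨by fun_prop, fun v => ?_⟩,
    fun v => by simp only [hinv'], fun k l v => ?_⟩
  · rw [proj_coordLift, proj_shearLift, hQ.2, proj_add_latticeVec]
    simp [twistMap]
  · have : Q (v + latticeVec (k, l) + latticeVec n) = Q (v + latticeVec n) + latticeVec (k, l) := by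
      rw [← hinv' (Q (v + latticeVec n) + latticeVec (k, l)), coordLift_add_latticeVec, hinv]
    simp only [this]
    rw [shearLift_add_latticeVec, coordLift_add_latticeVec]

/-- A fixed point of the square would lie over 1/4 or 3/4, where the square is a vertical half-turn.
-/
theorem twistMap_twistMap_ne (p : Torus) : twistMap (twistMap p) ≠ p := by
  intro h
  have h1 := coordChange_symm_iterate 2 p
  rw [show twistMap^[2] p = p from h] at h1
  obtain ⟨m, y, hy⟩ := exists_eq_quarter_of_isPeriodicPt two_pos h1.symm
  rw [hy, ← isLift_shearLift.iterate, Function.iterate_succ_apply, Function.iterate_one,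
    shearLift_quarter, shearLift_quarter] at h1
  obtain ⟨⟨k, l⟩, hkl⟩ := proj_eq_iff.1 h1
  have h2 := congrArg Prod.snd hkl
  simp only [latticeVec, Prod.snd_add] at h2
  push_cast at h2
  have h3 : 2 * m + 1 + 2 * l = 0 := by exact_mod_cast (by linarith : (2 * m + 1 + 2 * l : ℝ) = 0)
  omega

theorem range_iterate_of_four_cycle {α : Type*} {f : α → α} {a b c d : α} (hab : f a = b)
    (hbc : f b = c) (hcd : f c = d) (hda : f d = a) :
    Set.range (fun n : ℕ => f^[n] a) = {a, b, c, d} := by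
  apply Set.Subset.antisymm
  · rintro _ ⟨n, rfl⟩
    induction n with
    | zero => simp
    | succ n ih =>
      simp only [Function.iterate_succ_apply', Set.mem_insert_iff, Set.mem_singleton_iff] at ih ⊢
      rcases ih with h | h | h | h <;> simp [h, hab, hbc, hcd, hda]
  · rintro _ (rfl | rfl | rfl | rfl)
    exacts [⟨0, rfl⟩, ⟨1, hab⟩, ⟨2, by simp [hab, hbc]⟩, ⟨3, by simp [hab, hbc, hcd]⟩]

/-- The symmetries of `twistMap`. -/
noncomputable def symmetry (s : ℝ) : Torus ≃ₜ Torus :=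
  (coordChange.symm.trans (vshear (fun _ => (s : UnitAddCircle)) continuous_const)).trans coordChange

theorem symmetry_coordChange_proj (s : ℝ) (v : ℝ × ℝ) :
    symmetry s (coordChange (proj v)) = coordChange (proj (v + (0, s))) := by
  simp [symmetry, vshear, proj]

theorem isotopic_symmetry (s : ℝ) : Isotopic (symmetry s) (Homeomorph.refl Torus) := by
  refine ⟨fun t => symmetry ((1 - t) * s), ?_, by simp, ?_, by simp⟩
  · have h : Continuous fun t : ℝ => (((1 - t) * s : ℝ) : UnitAddCircle) :=
      (AddCircle.continuous_mk' (1 : ℝ)).comp (by fun_prop)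
    have h' := h.comp (continuous_subtype_val (p := (· ∈ unitInterval)))
    simp only [symmetry, vshear, Homeomorph.trans_apply, Homeomorph.homeomorph_mk_coe,
      Equiv.coe_fn_mk]
    refine coordChange.continuous.comp ?_
    have h2 : Continuous fun q : unitInterval × Torus => coordChange.symm q.2 :=
      coordChange.symm.continuous.comp continuous_snd
    exact h2.fst.prodMk (h2.snd.add (h'.comp continuous_fst))
  · ext1 p
    simp [symmetry, vshear]

/-- In the old coordinates the map adds to the height a function of the abscissa alone, so it
commutes with vertical translations. -/
theorem symmetry_twistMap (s : ℝ) (p : Torus) :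
    symmetry s (twistMap p) = twistMap (symmetry s p) := by
  simp [symmetry, twistMap, vshear, shearMap_apply, add_right_comm]

theorem proj_eighth_injective {a b : ℕ} (ha : a < 8) (hb : b < 8)
    (h : proj ((a : ℝ) / 8, 1 / 2) = proj ((b : ℝ) / 8, 1 / 2)) : a = b := by
  obtain ⟨⟨k, l⟩, hkl⟩ := proj_eq_iff.1 h
  have h2 := congrArg Prod.fst hkl
  simp only [latticeVec, Prod.fst_add] at h2
  have h3 : (a : ℤ) = b + 8 * k := by exact_mod_cast (by linarith : (a : ℝ) = b + 8 * k)
  omega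

end Torus

/-! ### The orbit of length 4 and its properties -/

theorem lemma2p4 :
    ∃ (f : Torus ≃ₜ Torus) (A₁ A₂ A₃ A₄ : Torus) (x : Set Torus),
      -- the orbit: four points evenly spaced on the horizontal middle line
      A₁ = Torus.proj (1 / 8, 1 / 2) ∧ A₂ = Torus.proj (3 / 8, 1 / 2) ∧
      A₃ = Torus.proj (5 / 8, 1 / 2) ∧ A₄ = Torus.proj (7 / 8, 1 / 2) ∧
      x = {A₁, A₂, A₃, A₄} ∧
      f A₁ = A₃ ∧ f A₃ = A₂ ∧ f A₂ = A₄ ∧ f A₄ = A₁ ∧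
      Torus.IsShear f ∧ Torus.IsPeriodicOrbit f x ∧ x.ncard = 4 ∧
      (∃ a b : ℤ × ℤ, Torus.IsStandardAxes f a b ∧ Torus.HasRotationNumber f a b x (1 / 2)) ∧
      -- it is of twist type and not simple
      Torus.IsTwistType f x ∧ ¬ Torus.IsSimpleOrbit f x ∧
      -- it forces no periodic orbit that is not similar to it
      (∀ (g : Torus ≃ₜ Torus) (y : Set Torus), Torus.IsPeriodicOrbit g y →
        Torus.Forces f x g y → Torus.Similar f x g y) ∧
      -- some map isotopic to `f` rel the orbit has no point of period 2
      (∃ h : Torus ≃ₜ Torus, Torus.IsotopicRel x f h ∧ ∀ p : Torus, h (h p) ≠ p) := by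
  open Torus in
  obtain ⟨F, hF, hFc, hFl⟩ := exists_isLift_twistMap
  -- the lifted orbit
  have c0 : coordLift (1 / 4 + ((0 : ℤ) : ℝ) / 2, 1 / 2) = (1 / 8, 1 / 2) := by
    simpa using (coordLift_quarter 0 0).1
  have c1 : coordLift (1 / 4 + ((1 : ℤ) : ℝ) / 2, 1 / 2) = (5 / 8, 1 / 2) := by
    have := (coordLift_quarter 1 0).1
    norm_num at this ⊢
    exact this
  have c2 : coordLift (1 / 4 + ((2 : ℤ) : ℝ) / 2, 1) = (3 / 8, 1 / 2) + latticeVec (1, 1) := by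
    have := (coordLift_quarter 2 1).2
    norm_num [latticeVec] at this ⊢
    exact this
  have c3 : coordLift (1 / 4 + ((3 : ℤ) : ℝ) / 2, 2) = (7 / 8, 1 / 2) + latticeVec (1, 2) := by
    have := (coordLift_quarter 3 2).2
    norm_num [latticeVec] at this ⊢
    exact this
  have c4 : coordLift (1 / 4 + ((4 : ℤ) : ℝ) / 2, 7 / 2) = (1 / 8, 1 / 2) + latticeVec (2, 3) := by
    have := (coordLift_quarter 4 3).1
    norm_num [latticeVec] at this ⊢
    exact this
  have s0 : shearLift (1 / 4 + ((0 : ℤ) : ℝ) / 2, 1 / 2) = (1 / 4 + ((1 : ℤ) : ℝ) / 2, 1 / 2) := by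
    rw [shearLift_quarter]; norm_num
  have s1 : shearLift (1 / 4 + ((1 : ℤ) : ℝ) / 2, 1 / 2) = (1 / 4 + ((2 : ℤ) : ℝ) / 2, 1) := by
    rw [shearLift_quarter]; norm_num
  have s2 : shearLift (1 / 4 + ((2 : ℤ) : ℝ) / 2, 1) = (1 / 4 + ((3 : ℤ) : ℝ) / 2, 2) := by
    rw [shearLift_quarter]; norm_num
  have s3 : shearLift (1 / 4 + ((3 : ℤ) : ℝ) / 2, 2) = (1 / 4 + ((4 : ℤ) : ℝ) / 2, 7 / 2) := by
    rw [shearLift_quarter]; norm_num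
  have f1 : twistMap (proj (1 / 8, 1 / 2)) = proj (5 / 8, 1 / 2) := by
    rw [← c0, twistMap_proj_coordLift, s0, c1]
  have f2 : twistMap (proj (5 / 8, 1 / 2)) = proj (3 / 8, 1 / 2) := by
    rw [← c1, twistMap_proj_coordLift, s1, c2, proj_add_latticeVec]
  have f3 : twistMap (proj (3 / 8, 1 / 2)) = proj (7 / 8, 1 / 2) := by
    rw [← proj_add_latticeVec _ (1, 1), ← c2, twistMap_proj_coordLift, s2, c3, proj_add_latticeVec]
  have f4 : twistMap (proj (7 / 8, 1 / 2)) = proj (1 / 8, 1 / 2) := by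
    rw [← proj_add_latticeVec _ (1, 2), ← c3, twistMap_proj_coordLift, s3, c4, proj_add_latticeVec]
  have F4 : F^[4] (1 / 8, 1 / 2) = (1 / 8, 1 / 2) + latticeVec (2, 3) := by
    have h := (Function.Semiconj.iterate_right (f := coordLift) (ga := shearLift) (gb := F)
      (fun v => (hFc v).symm) 4) (1 / 4 + ((0 : ℤ) : ℝ) / 2, 1 / 2)
    rw [c0] at h
    rw [← h]
    simp only [Function.iterate_succ_apply, Function.iterate_zero, id_eq, s0, s1, s2, s3, c4]
  set x : Set Torus :=
    {proj (1 / 8, 1 / 2), proj (3 / 8, 1 / 2), proj (5 / 8, 1 / 2), proj (7 / 8, 1 / 2)} with hx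
  have r1 : Set.range (fun n : ℕ => twistMap^[n] (proj (1 / 8, 1 / 2))) = x := by
    rw [range_iterate_of_four_cycle f1 f2 f3 f4, hx]
    ext p
    simp only [Set.mem_insert_iff, Set.mem_singleton_iff]
    tauto
  have r2 : Set.range (fun n : ℕ => twistMap^[n] (proj (5 / 8, 1 / 2))) = x := by
    rw [range_iterate_of_four_cycle f2 f3 f4 f1, hx]
    ext p
    simp only [Set.mem_insert_iff, Set.mem_singleton_iff]
    tauto
  have hper : IsPeriodicOrbit twistMap x := by
    refine ⟨proj (1 / 8, 1 / 2), ⟨4, by norm_num, ?_⟩, r1.symm⟩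
    show twistMap (twistMap (twistMap (twistMap (proj (1 / 8, 1 / 2))))) = _
    rw [f1, f2, f3, f4]
  have hcard : x.ncard = 4 := by
    have h := fun a b ha hb => mt (proj_eighth_injective (a := a) (b := b) ha hb)
    have h13 := h 1 3 (by norm_num) (by norm_num) (by norm_num)
    have h15 := h 1 5 (by norm_num) (by norm_num) (by norm_num)
    have h17 := h 1 7 (by norm_num) (by norm_num) (by norm_num)
    have h35 := h 3 5 (by norm_num) (by norm_num) (by norm_num)
    have h37 := h 3 7 (by norm_num) (by norm_num) (by norm_num)
    have h57 := h 5 7 (by norm_num) (by norm_num) (by norm_num)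
    push_cast at h13 h15 h17 h35 h37 h57
    rw [hx, Set.ncard_insert_of_notMem, Set.ncard_insert_of_notMem, Set.ncard_pair h57]
    · simp only [Set.mem_insert_iff, Set.mem_singleton_iff, not_or]
      exact ⟨h35, h37⟩
    · simp only [Set.mem_insert_iff, Set.mem_singleton_iff, not_or]
      exact ⟨h13, h15, h17⟩
  have hforce : ∀ (g : Torus ≃ₜ Torus) (y : Set Torus), Forces twistMap x g y →
      Similar twistMap x g y := by
    intro g y
    refine similar_of_forces hper ?_
    rintro _ ⟨q, ⟨n, hn, hq⟩, rfl⟩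
    obtain ⟨m, Y, hm⟩ := exists_eq_quarter_of_isPeriodicPt (p := coordChange.symm q) hn
      (by rw [← coordChange_symm_iterate, hq])
    have hq' : q = coordChange (proj (1 / 4 + (m : ℝ) / 2, Y)) := by rw [← hm]; simp
    -- The parity of `m` tells which of the two circles carries `q`. The orbit `x` has a point at
    -- old height 1/2 on each, so a vertical translation by `Y - 1/2` takes that point to `q`.
    obtain ⟨p, hpx, hpq⟩ : ∃ p, Set.range (fun n : ℕ => twistMap^[n] p) = x ∧
        symmetry (Y - 1 / 2) p = q := by
      rcases Int.even_or_odd' m with ⟨k, rfl | rfl⟩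
      · refine ⟨_, r1, ?_⟩
        rw [hq', ← c0, proj_coordLift, symmetry_coordChange_proj]
        congr 1
        exact proj_eq_iff.2 ⟨(-k, 0), by ext <;> simp [latticeVec]⟩
      · refine ⟨_, r2, ?_⟩
        rw [hq', ← c1, proj_coordLift, symmetry_coordChange_proj]
        congr 1
        exact proj_eq_iff.2 ⟨(-k, 0), by ext <;> simp [latticeVec]; ring⟩
    refine ⟨symmetry (Y - 1 / 2), isotopic_symmetry _, ?_, symmetry_twistMap _⟩
    rw [← hpx, ← Set.range_comp, ← hpq]
    congr 1
    funext n
    exact (Function.Semiconj.iterate_right (f := symmetry (Y - 1 / 2)) (symmetry_twistMap _) n) p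
  have hFa : ∀ v, F (v + latticeVec (1, 0)) = F v + latticeVec (1, 1) := fun v => by
    simpa using hFl 1 0 v
  have hFb : ∀ v, F (v + latticeVec (0, 1)) = F v + latticeVec (0, 1) := fun v => by
    simpa using hFl 0 1 v
  have hz : proj (1 / 8, 1 / 2) ∈ x := Or.inl rfl
  refine ⟨twistMap, _, _, _, _, x, rfl, rfl, rfl, rfl, hx, f1, f2, f3, f4, isShear_twistMap, hper,
    hcard, ⟨(1, 0), (0, 1), ⟨by simp, F, hF, fun v => ⟨?_, hFb v⟩⟩, F, hF, _, hz, 2, 3, ?_, ?_⟩,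
    fun g y _ _ => hforce g y, fun hs => ?_, fun g y _ => hforce g y, twistMap,
    ⟨fun _ => twistMap, twistMap.continuous.comp continuous_snd, rfl, rfl, fun _ _ _ => rfl⟩,
    twistMap_twistMap_ne⟩
  · simpa using hFa v
  · rw [hcard, F4]
    simp
  · rw [hcard]
    norm_num
  -- Length 4 and horizontal advance 2: already n = 2 gives 4 ∣ 2 · 2.
  · exact hs.not_dvd hF hFa hFb hz (by rw [hcard]; exact F4) (n := 2) two_pos
      (by rw [hcard]; norm_num) (by rw [hcard]; norm_num)
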